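/- Let $K:[0,\infty)\to[0,\infty)$ satisfy: (K1) $K$ is lower semicontinuous and non-decreasing with $K(0)=0$; (K2) for every $M>0$ there is a constant $C_M>0$ such that $K(\rho_1)+K(\rho_2)\ge K(\rho_1+\rho_2)+C_M\rho_1\rho_2$ for all $\rho_1,\rho_2\ge 0$ with $\rho_1+\rho_2\le M$; (K3) $\lim_{\rho\downarrow 0}K(\rho)/\rho=1$. Let $a<b$, $\lambda>0$ and $g\in L^\infty(a,b)$. For $u\in BV(a,b)$, with distributional derivative $Du$, approximate jump set $J_u\subset(a,b)$ and one-sided traces $u^\pm$ on $J_u$, put \[ TV_{Kg}(u)=|Du|\bigl((a,b)\setminus J_u\bigr)+\sum_{x\in J_u}K\bigl(|u^+-u^-|(x)\bigr)+\frac{\lambda}{2}\int_a^b|u-g|^2\,dx . \] Assume that $g$ is non-decreasing (resp. non-increasing), i.e. agrees almost everywhere on $(a,b)$ with such a function. Let $M>0$ satisfy $M\ge\operatorname{ess\,sup}_{(a,b)}g-\operatorname{ess\,inf}_{(a,b)}g$, and let $C_M>0$ be any constant for which the inequality in (K2) holds for this $M$. Let $U\in BV(a,b)$ be a minimizer of $TV_{Kg}$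 over $BV(a,b)$. Then $J_U$ is finite, and $U$ agrees almost everywhere on $(a,b)$ with a function $V$ on $[a,b]$ that is non-decreasing (resp. non-increasing), is constant on each component of $[a,b]\setminus J_U$, and satisfies $\operatorname{ess\,inf}g\le V\le\operatorname{ess\,sup}g$ on $[a,b]$. Moreover, the number $m$ of jumps of $U$ (the number of elements of $J_U$) satisfies \[ m\le\left[\frac{(b-a)\lambda}{2C_M}\right]+1, \] where $[r]$ denotes the integer part of $r\ge 0$. -/

import Mathlib

open MeasureTheory Set Filter Topology
open scoped NNReal ENNReal ContDiff

namespace KWC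

/-! ### Functions of bounded variation on an open interval -/

/-- The signed measure `D` is the distributional derivative of `u` on `(a, b)`:
`∫ u φ' = - ∫ φ dD` for every smooth `φ` with compact support in `(a, b)`.
Only the part of `D` inside `(a, b)` matters. -/
def IsDistribDeriv (a b : ℝ) (u : ℝ → ℝ) (D : SignedMeasure ℝ) : Prop :=
  ∀ φ : ℝ → ℝ, ContDiff ℝ ∞ φ → HasCompactSupport φ → tsupport φ ⊆ Ioo a b →
    ∫ x in Ioo a b, u x * deriv φ x = - ∫ᵛ x, φ x ∂<•D

/-- `u ∈ BV(a, b)`: `u` is integrable and its distributional derivative is a finite measure. -/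
def MemBV (a b : ℝ) (u : ℝ → ℝ) : Prop :=
  IntegrableOn u (Ioo a b) ∧ ∃ D : SignedMeasure ℝ, IsDistribDeriv a b u D

open scoped Classical in
/-- The distributional derivative `Du` of `u ∈ BV(a, b)`; it is unique inside `(a, b)`, see
`IsDistribDeriv.restrict_eq`. -/
noncomputable def distribDeriv (a b : ℝ) (u : ℝ → ℝ) : SignedMeasure ℝ :=
  if h : ∃ D : SignedMeasure ℝ, IsDistribDeriv a b u D then h.choose else 0

/-! ### One-sided traces and the approximate jump set -/

/-- `p` is the approximate left limit of `u` at `x`. -/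
def IsLeftTrace (u : ℝ → ℝ) (x p : ℝ) : Prop :=
  Tendsto (fun r : ℝ => r⁻¹ * ∫ y in Ioo (x - r) x, |u y - p|) (𝓝[>] 0) (𝓝 0)

/-- `q` is the approximate right limit of `u` at `x`. -/
def IsRightTrace (u : ℝ → ℝ) (x q : ℝ) : Prop :=
  Tendsto (fun r : ℝ => r⁻¹ * ∫ y in Ioo x (x + r), |u y - q|) (𝓝[>] 0) (𝓝 0)

/-- The approximate jump set `J_u` of `u` in `(a, b)`. -/
def jumpSet (a b : ℝ) (u : ℝ → ℝ) : Set ℝ :=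
  {x | x ∈ Ioo a b ∧ ∃ p q : ℝ, p ≠ q ∧ IsLeftTrace u x p ∧ IsRightTrace u x q}

/-- The left trace `u(x - 0)` (unique when it exists, see `IsLeftTrace.unique`). -/
noncomputable def leftTrace (u : ℝ → ℝ) (x : ℝ) : ℝ := Classical.epsilon (IsLeftTrace u x)

/-- The right trace `u(x + 0)` (unique when it exists, see `IsRightTrace.unique`). -/
noncomputable def rightTrace (u : ℝ → ℝ) (x : ℝ) : ℝ := Classical.epsilon (IsRightTrace u x)

/-- The jump size `|u⁺ - u⁻|` at `x`. -/
noncomputable def jumpSize (u : ℝ → ℝ) (x : ℝ) : ℝ≥0 := nndist (leftTrace u x) (rightTrace u x)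

/-! ### The energy -/

/-- `TV_K(u) = |Du|((a, b) \ J_u) + ∑_{x ∈ J_u} K(|u⁺ - u⁻|(x))`; in dimension one the Hausdorff
measure on the jump set is the counting measure. -/
noncomputable def TVK (K : ℝ≥0 → ℝ≥0) (a b : ℝ) (u : ℝ → ℝ) : ℝ≥0∞ :=
  (distribDeriv a b u).variation (Ioo a b \ jumpSet a b u)
    + ∑' x : jumpSet a b u, (K (jumpSize u x) : ℝ≥0∞)

/-- The fidelity term `(lam / 2) ∫ |u - g|²`. -/
noncomputable def fidelity (lam a b : ℝ) (g u : ℝ → ℝ) : ℝ≥0∞ :=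
  ENNReal.ofReal (lam / 2) * ∫⁻ x in Ioo a b, ENNReal.ofReal ((u x - g x) ^ 2)

/-- `TV_{Kg} = TV_K + fidelity`. -/
noncomputable def TVKg (K : ℝ≥0 → ℝ≥0) (lam a b : ℝ) (g u : ℝ → ℝ) : ℝ≥0∞ :=
  TVK K a b u + fidelity lam a b g u

/-- `U` minimizes `TV_{Kg}` over `BV(a, b)`. -/
def IsMinimizer (K : ℝ≥0 → ℝ≥0) (lam a b : ℝ) (g U : ℝ → ℝ) : Prop :=
  MemBV a b U ∧ ∀ u : ℝ → ℝ, MemBV a b u → TVKg K lam a b g U ≤ TVKg K lam a b g u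

/-! ### The assumptions on the jump cost -/

/-- The quantitative subadditivity inequality of `K` up to total size `M`, with constant `C`. -/
def SubaddWith (K : ℝ≥0 → ℝ≥0) (M C : ℝ) : Prop :=
  ∀ r s : ℝ≥0, (r + s : ℝ) ≤ M → (K (r + s) : ℝ) + C * r * s ≤ K r + K s

/-- The admissible jump costs `K : [0, ∞) → [0, ∞)`. -/
structure Admissible (K : ℝ≥0 → ℝ≥0) : Prop where
  lsc : LowerSemicontinuous K
  mono : Monotone K
  map_zero : K 0 = 0
  subadd : ∀ M : ℝ, 0 < M → ∃ C : ℝ, 0 < C ∧ SubaddWith K M C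
  slope : Tendsto (fun r : ℝ≥0 => K r / r) (𝓝[>] 0) (𝓝 1)

/-! ### Monotone bounded data, piecewise constant functions -/

/-- `g` agrees almost everywhere on `(a, b)` with a non-decreasing function. -/
def AENondecreasing (a b : ℝ) (g : ℝ → ℝ) : Prop :=
  ∃ h : ℝ → ℝ, MonotoneOn h (Ioo a b) ∧ g =ᵐ[volume.restrict (Ioo a b)] h

/-- `g` agrees almost everywhere on `(a, b)` with a non-increasing function. -/
def AENonincreasing (a b : ℝ) (g : ℝ → ℝ) : Prop :=
  ∃ h : ℝ → ℝ, AntitoneOn h (Ioo a b) ∧ g =ᵐ[volume.restrict (Ioo a b)] h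

/-- `V` is piecewise constant on `[a, b]` with finitely many breakpoints, which form the set `S`:
`S` is a finite subset of `(a, b)` and `V` is constant on each component of `[a, b] \ S`. -/
def PiecewiseConst (a b : ℝ) (S : Set ℝ) (V : ℝ → ℝ) : Prop :=
  S.Finite ∧ S ⊆ Ioo a b ∧
    ∀ x ∈ Icc a b, ∀ y ∈ Icc a b, x ≤ y → Disjoint (Icc x y) S → V x = V y

/-! ### Uniqueness of the derivative and of the traces -/

lemma IsDistribDeriv.apply_Ioo {a b : ℝ} {u : ℝ → ℝ} {D : SignedMeasure ℝ}
    (hD : IsDistribDeriv a b u D) {c d : ℝ} (hc : a ≤ c) (hd : d ≤ b) :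
    Tendsto (fun n : ℕ => - ∫ x in Ioo a b, u x * deriv (fun y : ℝ =>
      Real.smoothTransition (n * (y - c) - 1) * Real.smoothTransition (n * (d - y) - 1)) x)
      atTop (𝓝 (D (Ioo c d))) := by
  have hfin : IsFiniteMeasure D.variation := by
    rw [← SignedMeasure.totalVariation_eq_variation]; infer_instance
  have hsmooth : ∀ n : ℕ, ContDiff ℝ ∞ (fun y : ℝ =>
      Real.smoothTransition (n * (y - c) - 1) * Real.smoothTransition (n * (d - y) - 1)) := by
    intro n
    exact (Real.smoothTransition.contDiff.comp (by fun_prop)).mul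
      (Real.smoothTransition.contDiff.comp (by fun_prop))
  have hlim : ∫ᵛ x, (Ioo c d).indicator (fun _ => (1 : ℝ)) x ∂<•D = D (Ioo c d) := by
    rw [VectorMeasure.integral_indicator_const]
    · simp
    · exact measurableSet_Ioo
  rw [← hlim]
  have hpt : ∀ x : ℝ, Tendsto (fun n : ℕ => Real.smoothTransition (n * (x - c) - 1) *
      Real.smoothTransition (n * (d - x) - 1)) atTop
      (𝓝 ((Ioo c d).indicator (fun _ => (1 : ℝ)) x)) := by
    intro x
    by_cases hx : x ∈ Ioo c d
    · rw [indicator_of_mem hx]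
      refine tendsto_const_nhds.congr' ?_
      have t1 : Tendsto (fun n : ℕ => (n : ℝ) * (x - c)) atTop atTop :=
        tendsto_natCast_atTop_atTop.atTop_mul_const (by linarith [hx.1])
      have t2 : Tendsto (fun n : ℕ => (n : ℝ) * (d - x)) atTop atTop :=
        tendsto_natCast_atTop_atTop.atTop_mul_const (by linarith [hx.2])
      filter_upwards [t1.eventually_ge_atTop 2, t2.eventually_ge_atTop 2] with n h1 h2
      rw [Real.smoothTransition.one_of_one_le (by linarith),
        Real.smoothTransition.one_of_one_le (by linarith), one_mul]
    · rw [indicator_of_notMem hx]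
      refine tendsto_const_nhds.congr fun n => ?_
      have hn : (0 : ℝ) ≤ n := Nat.cast_nonneg n
      rcases le_or_gt x c with h | h
      · rw [Real.smoothTransition.zero_of_nonpos, zero_mul]
        nlinarith
      · have h' : d ≤ x := not_lt.1 fun h' => hx ⟨h, h'⟩
        rw [Real.smoothTransition.zero_of_nonpos (x := n * (d - x) - 1), mul_zero]
        nlinarith
  have key : Tendsto (fun n : ℕ => ∫ᵛ y, Real.smoothTransition (n * (y - c) - 1) *
      Real.smoothTransition (n * (d - y) - 1) ∂<•D) atTop
      (𝓝 (∫ᵛ y, (Ioo c d).indicator (fun _ => (1 : ℝ)) y ∂<•D)) :=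
    VectorMeasure.tendsto_integral_of_dominated_convergence (fun _ => 1)
    (fun n => (hsmooth n).continuous.aestronglyMeasurable) (integrable_const _)
    (fun n => Eventually.of_forall fun x => by
      rw [Real.norm_of_nonneg (mul_nonneg (Real.smoothTransition.nonneg _)
        (Real.smoothTransition.nonneg _))]
      exact mul_le_one₀ (Real.smoothTransition.le_one _) (Real.smoothTransition.nonneg _)
        (Real.smoothTransition.le_one _))
    (Eventually.of_forall hpt)
  refine key.congr' ?_
  filter_upwards [eventually_gt_atTop 0] with n hn
  have hn' : (0 : ℝ) < n := by exact_mod_cast hn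
  have hsub : tsupport (fun y : ℝ => Real.smoothTransition (n * (y - c) - 1) *
      Real.smoothTransition (n * (d - y) - 1)) ⊆ Icc (c + 1 / n) (d - 1 / n) := by
    refine closure_minimal (fun y hy => ?_) isClosed_Icc
    have h1 : Real.smoothTransition (n * (y - c) - 1) ≠ 0 := left_ne_zero_of_mul hy
    have h2 : Real.smoothTransition (n * (d - y) - 1) ≠ 0 := right_ne_zero_of_mul hy
    rw [Ne, Real.smoothTransition.zero_iff_nonpos, not_le] at h1 h2
    constructor
    · have : 1 / n < y - c := by rw [div_lt_iff₀ hn']; linarith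
      linarith
    · have : 1 / n < d - y := by rw [div_lt_iff₀ hn']; linarith
      linarith
  have hpos : (0 : ℝ) < 1 / n := by positivity
  rw [hD _ (hsmooth n) (HasCompactSupport.of_support_subset_isCompact isCompact_Icc
    (subset_closure.trans hsub)) (hsub.trans fun y hy => ⟨by linarith [hy.1], by linarith [hy.2]⟩),
    neg_neg]

/-- Two distributional derivatives of the same function agree inside `(a, b)`. -/
theorem IsDistribDeriv.restrict_eq {a b : ℝ} {u : ℝ → ℝ} {D D' : SignedMeasure ℝ}
    (hD : IsDistribDeriv a b u D) (hD' : IsDistribDeriv a b u D') :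
    D.restrict (Ioo a b) = D'.restrict (Ioo a b) := by
  have hIoo : ∀ c d : ℝ, a ≤ c → d ≤ b → D (Ioo c d) = D' (Ioo c d) := fun c d hc hd =>
    tendsto_nhds_unique (hD.apply_Ioo hc hd) (hD'.apply_Ioo hc hd)
  ext s hs
  induction s, hs using MeasurableSpace.induction_on_inter
    ((BorelSpace.measurable_eq (α := ℝ)).trans Real.borel_eq_generateFrom_Ioo_rat)
    Real.isPiSystem_Ioo_rat with
  | empty => simp
  | basic t ht =>
    simp only [mem_iUnion, mem_singleton_iff] at ht
    obtain ⟨p, q, -, rfl⟩ := ht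
    rw [VectorMeasure.restrict_apply _ measurableSet_Ioo measurableSet_Ioo,
      VectorMeasure.restrict_apply _ measurableSet_Ioo measurableSet_Ioo, Ioo_inter_Ioo]
    exact hIoo _ _ le_sup_right inf_le_right
  | compl t htm h =>
    rw [VectorMeasure.of_compl htm, VectorMeasure.of_compl htm, h]
    simp [hIoo a b le_rfl le_rfl]
  | iUnion f hd hm h =>
    rw [VectorMeasure.of_disjoint_iUnion hm hd, VectorMeasure.of_disjoint_iUnion hm hd]
    exact tsum_congr h

theorem MemBV.isDistribDeriv {a b : ℝ} {u : ℝ → ℝ} (hu : MemBV a b u) :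
    IsDistribDeriv a b u (distribDeriv a b u) := by
  rw [distribDeriv, dif_pos hu.2]
  exact hu.2.choose_spec

lemma trace_bound {s : ℝ → Set ℝ} (hs : ∀ r, MeasurableSet (s r))
    (hvol : ∀ r, 0 < r → volume (s r) = ENNReal.ofReal r) {u : ℝ → ℝ} {p q : ℝ}
    (hu : ∀ᶠ r in 𝓝[>] (0 : ℝ), IntegrableOn u (s r))
    (hp : Tendsto (fun r : ℝ => r⁻¹ * ∫ y in s r, |u y - p|) (𝓝[>] 0) (𝓝 0))
    (hq : Tendsto (fun r : ℝ => r⁻¹ * ∫ y in s r, |u y - q|) (𝓝[>] 0) (𝓝 0)) : p = q := by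
  have h := hp.add hq
  have hle : |p - q| ≤ 0 + 0 := by
    refine ge_of_tendsto h ?_
    filter_upwards [hu, self_mem_nhdsWithin] with r hr hr0
    have hr0' : (0 : ℝ) < r := hr0
    have hfin : volume (s r) ≠ ⊤ := by rw [hvol r hr0']; exact ENNReal.ofReal_ne_top
    have i1 : IntegrableOn (fun y => |u y - p|) (s r) :=
      (Integrable.sub hr (integrableOn_const hfin)).abs
    have i2 : IntegrableOn (fun y => |u y - q|) (s r) :=
      (Integrable.sub hr (integrableOn_const hfin)).abs
    have h1 : ∫ _ in s r, |p - q| = r * |p - q| := by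
      rw [setIntegral_const, measureReal_def, hvol r hr0', ENNReal.toReal_ofReal hr0'.le,
        smul_eq_mul]
    have h2 : ∫ _ in s r, |p - q| ≤ ∫ y in s r, (|u y - p| + |u y - q|) := by
      refine setIntegral_mono_on (integrableOn_const hfin) (i1.add i2) (hs r) fun y _ => ?_
      have := abs_sub_le p (u y) q
      rwa [abs_sub_comm p (u y)] at this
    rw [integral_add i1 i2, h1] at h2
    rw [← mul_add, le_inv_mul_iff₀ hr0']
    exact h2
  rw [add_zero] at hle
  exact sub_eq_zero.1 (abs_nonpos_iff.1 hle)

theorem IsLeftTrace.unique {a b x p q : ℝ} {u : ℝ → ℝ} (hu : IntegrableOn u (Ioo a b))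
    (hx : x ∈ Ioo a b) (hp : IsLeftTrace u x p) (hq : IsLeftTrace u x q) : p = q := by
  refine trace_bound (s := fun r => Ioo (x - r) x) (fun _ => measurableSet_Ioo)
    (fun r _ => by simp) ?_ hp hq
  filter_upwards [Ioo_mem_nhdsGT (sub_pos.2 hx.1)] with r hr
  exact hu.mono_set (Ioo_subset_Ioo (by linarith [hr.2]) hx.2.le)

theorem IsRightTrace.unique {a b x p q : ℝ} {u : ℝ → ℝ} (hu : IntegrableOn u (Ioo a b))
    (hx : x ∈ Ioo a b) (hp : IsRightTrace u x p) (hq : IsRightTrace u x q) : p = q := by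
  refine trace_bound (s := fun r => Ioo x (x + r)) (fun _ => measurableSet_Ioo)
    (fun r _ => by simp) ?_ hp hq
  filter_upwards [Ioo_mem_nhdsGT (sub_pos.2 hx.2)] with r hr
  exact hu.mono_set (Ioo_subset_Ioo hx.1.le (by linarith [hr.2]))

end KWC

namespace KWC

/-! ### Primitives of signed measures -/

/-! In one dimension a `BV` function is almost everywhere a primitive `P = k + μ((-∞, x])` of its
derivative, its jumps are the atoms of `μ`, and the first part of the energy is `kvar K μ (a, b)`.
Minimality then localizes: on `[s, t]` the measure may be replaced by any other with the same total
mass (`IsMinPrim.local_le`). All competitors used are point masses (`bridge`).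

Cutting an excursion of `P` beyond a level `c` down to `c` does not raise the jump cost, since the
jumps at the ends only shrink and `K` is non-decreasing. If `g` stays on the other side of `c`, the
fidelity strictly drops, which is impossible (`false_of_closer`). This confines `P` to the range of
`g` and makes it monotone with `g`.

Now let `P` increase from `α` to `β` on `[s, t]`. The competitor has a single jump from `α` to `β`,
placed where `g` crosses `(α + β) / 2`. Its fidelity exceeds that of `P` by at most `lam / 2 * (t -
s) * S`, with `S` the supremum of `(P - α) * (β - P)`. By the quantitative subadditivity it saves at
least `C * (P z - α) * (β - P z)` of jump cost, for every `z` (`mul_le`). Hence `C * S ≤ lam / 2 *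
(t - s) * S`, and `S = 0` as soon as `lam / 2 * (t - s) < C`: on short intervals `P` takes only the
two extreme values (`eq_or_eq`). So `P` is locally constant off its jumps, two jumps are at least `2
* C / lam` apart, and counting them gives the bound. -/

instance isFiniteMeasure_variation (μ : SignedMeasure ℝ) : IsFiniteMeasure μ.variation := by
  rw [← SignedMeasure.totalVariation_eq_variation]; infer_instance

/-- The right-continuous primitive of `μ` with value `k` at `-∞`. -/
noncomputable def prim (k : ℝ) (μ : SignedMeasure ℝ) (x : ℝ) : ℝ := k + μ (Iic x)

/-- The left-continuous primitive of `μ` with value `k` at `-∞`. -/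
noncomputable def primLeft (k : ℝ) (μ : SignedMeasure ℝ) (x : ℝ) : ℝ := k + μ (Iio x)

lemma primLeft_add_singleton (k : ℝ) (μ : SignedMeasure ℝ) (x : ℝ) :
    primLeft k μ x + μ {x} = prim k μ x := by
  have : Iic x = Iio x ∪ {x} := by ext y; simp [le_iff_lt_or_eq]
  rw [prim, primLeft, this, VectorMeasure.of_union (by simp) measurableSet_Iio
    (measurableSet_singleton x), add_assoc]

lemma prim_add_Ioc (k : ℝ) (μ : SignedMeasure ℝ) {x y : ℝ} (h : x ≤ y) :
    prim k μ x + μ (Ioc x y) = prim k μ y := by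
  rw [prim, prim, ← Iic_union_Ioc_eq_Iic h, VectorMeasure.of_union
    (by rw [Set.disjoint_left]; intro z hz hz'; exact (hz'.1.trans_le hz).false)
    measurableSet_Iic measurableSet_Ioc, add_assoc]

lemma primLeft_add_Icc (k : ℝ) (μ : SignedMeasure ℝ) {x y : ℝ} (h : x ≤ y) :
    primLeft k μ x + μ (Icc x y) = prim k μ y := by
  rw [primLeft, prim, ← Iio_union_Icc_eq_Iic h, VectorMeasure.of_union
    (by rw [Set.disjoint_left]; intro z hz hz'; exact (hz'.1.trans_lt hz).false)
    measurableSet_Iio measurableSet_Icc, add_assoc]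

/-- Dominated convergence for indicators, integrated against `μ`. It supplies the one-sided limits
of primitives. -/
lemma tendsto_signedMeasure {ι : Type*} {l : Filter ι} [l.IsCountablyGenerated]
    (μ : SignedMeasure ℝ) {s : ι → Set ℝ} {t : Set ℝ} (hs : ∀ i, MeasurableSet (s i))
    (ht : MeasurableSet t) (h : ∀ x, ∀ᶠ i in l, x ∈ s i ↔ x ∈ t) :
    Tendsto (fun i => μ (s i)) l (𝓝 (μ t)) := by
  have key : ∀ s : Set ℝ, MeasurableSet s →
      ∫ᵛ x, s.indicator (fun _ => (1 : ℝ)) x ∂<•μ = μ s := by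
    intro s hs
    rw [VectorMeasure.integral_indicator_const _ hs]
    simp
  rw [← key t ht]
  simp_rw [← fun i => key (s i) (hs i)]
  refine VectorMeasure.tendsto_integral_filter_of_dominated_convergence (fun _ => 1)
    (Eventually.of_forall fun i => (measurable_const.indicator (hs i)).aestronglyMeasurable)
    (Eventually.of_forall fun i => Eventually.of_forall fun x => ?_) (integrable_const _)
    (Eventually.of_forall fun x => ?_)
  · by_cases hx : x ∈ s i <;> simp [hx]
  · refine tendsto_const_nhds.congr' ?_
    filter_upwards [h x] with i hi
    by_cases hx : x ∈ t <;> simp [hi, hx]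

lemma tendsto_prim_right (k : ℝ) (μ : SignedMeasure ℝ) (x : ℝ) :
    Tendsto (prim k μ) (𝓝[>] x) (𝓝 (prim k μ x)) := by
  refine tendsto_const_nhds.add (tendsto_signedMeasure μ (fun _ => measurableSet_Iic)
    measurableSet_Iic fun z => ?_)
  rcases le_or_gt z x with h | h
  · filter_upwards [self_mem_nhdsWithin] with y hy
    have hy : x < y := hy
    simp [h, h.trans hy.le]
  · filter_upwards [Ioo_mem_nhdsGT h] with y hy
    simp [h.not_ge, hy.2.not_ge]

lemma tendsto_prim_left (k : ℝ) (μ : SignedMeasure ℝ) (x : ℝ) :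
    Tendsto (prim k μ) (𝓝[<] x) (𝓝 (primLeft k μ x)) := by
  refine tendsto_const_nhds.add (tendsto_signedMeasure μ (fun _ => measurableSet_Iic)
    measurableSet_Iio fun z => ?_)
  rcases lt_or_ge z x with h | h
  · filter_upwards [Ioo_mem_nhdsLT h] with y hy
    simp [h, hy.1.le]
  · filter_upwards [self_mem_nhdsWithin] with y hy
    have hy : y < x := hy
    simp [h.not_gt, (hy.trans_le h).not_ge]

lemma signedMeasure_eq_jordan (μ : SignedMeasure ℝ) {s : Set ℝ} (hs : MeasurableSet s) :
    μ s = μ.toJordanDecomposition.posPart.real s - μ.toJordanDecomposition.negPart.real s := by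
  conv_lhs => rw [← SignedMeasure.toSignedMeasure_toJordanDecomposition μ]
  rw [JordanDecomposition.toSignedMeasure, Measure.toSignedMeasure_sub_apply hs]

lemma monotone_measureReal_Iic (p : Measure ℝ) [IsFiniteMeasure p] :
    Monotone fun x => p.real (Iic x) :=
  fun _ _ h => measureReal_mono (Iic_subset_Iic.2 h)

lemma measurable_prim (k : ℝ) (μ : SignedMeasure ℝ) : Measurable (prim k μ) := by
  have : prim k μ = fun x => k + (μ.toJordanDecomposition.posPart.real (Iic x)
      - μ.toJordanDecomposition.negPart.real (Iic x)) := by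
    ext x; rw [prim, signedMeasure_eq_jordan μ measurableSet_Iic]
  rw [this]
  exact measurable_const.add ((monotone_measureReal_Iic _).measurable.sub
    (monotone_measureReal_Iic _).measurable)

lemma abs_prim_le (k : ℝ) (μ : SignedMeasure ℝ) (x : ℝ) :
    |prim k μ x| ≤ |k| + μ.variation.real univ := by
  refine (abs_add_le _ _).trans (add_le_add_right ?_ _)
  rw [← Real.norm_eq_abs]
  exact (VectorMeasure.norm_measure_le_variation).trans (measureReal_mono (subset_univ _))

lemma integrableOn_prim (a b k : ℝ) (μ : SignedMeasure ℝ) : IntegrableOn (prim k μ) (Ioo a b) :=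
  Measure.integrableOn_of_bounded (by simp) (measurable_prim k μ).aestronglyMeasurable
    (M := |k| + μ.variation.real univ)
    (Eventually.of_forall fun x => by rw [Real.norm_eq_abs]; exact abs_prim_le k μ x)

/-- Fubini: `p (Iic x)` is the integral of the indicator of `y ≤ x` in `y`, and the integral of `φ'`
over `[y, ∞)` is `-φ y`. -/
lemma integral_measureReal_Iic_mul_deriv (p : Measure ℝ) [IsFiniteMeasure p] {φ : ℝ → ℝ}
    (hφ : ContDiff ℝ 1 φ) (hc : HasCompactSupport φ) :
    Integrable (fun x => p.real (Iic x) * deriv φ x) ∧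
      ∫ x, p.real (Iic x) * deriv φ x = - ∫ x, φ x ∂p := by
  have hd : Continuous (deriv φ) := hφ.continuous_deriv le_rfl
  have hi : Integrable (deriv φ) := hd.integrable_of_hasCompactSupport hc.deriv
  refine ⟨hi.bdd_mul (c := p.real univ) (monotone_measureReal_Iic p).measurable.aestronglyMeasurable
    (Eventually.of_forall fun x => ?_), ?_⟩
  · rw [Real.norm_of_nonneg measureReal_nonneg]; exact measureReal_mono (subset_univ _)
  have h1 : ∀ x, p.real (Iic x) * deriv φ x =
      ∫ y, (Ici y).indicator (deriv φ) x ∂p := by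
    intro x
    have : ∀ y, (Ici y).indicator (deriv φ) x = (Iic x).indicator (fun _ => deriv φ x) y := by
      intro y; simp [indicator]
    simp_rw [this]
    rw [integral_indicator measurableSet_Iic]
    simp [measureReal_def]
  simp_rw [h1]
  rw [integral_integral_swap]
  · rw [← integral_neg]
    refine integral_congr_ae (Eventually.of_forall fun y => ?_)
    simp only
    rw [integral_indicator measurableSet_Ici, integral_Ici_eq_integral_Ioi,
      hc.integral_Ioi_deriv_eq hφ]
  · have hs : MeasurableSet {q : ℝ × ℝ | q.2 ≤ q.1} := measurableSet_le measurable_snd measurable_fst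
    have : (Function.uncurry fun x y => (Ici y).indicator (deriv φ) x) =
        {q : ℝ × ℝ | q.2 ≤ q.1}.indicator (fun q => deriv φ q.1) := by
      ext ⟨x, y⟩; simp [indicator]
    rw [this]
    exact (hi.comp_fst p).indicator hs

lemma integral_deriv_eq_zero {φ : ℝ → ℝ} (hφ : ContDiff ℝ 1 φ) (hc : HasCompactSupport φ) :
    ∫ x, deriv φ x = 0 :=
  integral_eq_zero_of_hasDerivAt_of_integrable
    (fun x => (hφ.differentiable one_ne_zero x).hasDerivAt)
    ((hφ.continuous_deriv le_rfl).integrable_of_hasCompactSupport hc.deriv)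
    (hφ.continuous.integrable_of_hasCompactSupport hc)

lemma isDistribDeriv_prim (a b k : ℝ) (μ : SignedMeasure ℝ) :
    IsDistribDeriv a b (prim k μ) μ := by
  intro φ hφ hc hsupp
  have hφ1 : ContDiff ℝ 1 φ := hφ.of_le (by exact_mod_cast le_top)
  rw [setIntegral_eq_integral_of_forall_compl_eq_zero]
  swap
  · intro x hx
    have : deriv φ x = 0 := by
      by_contra h
      exact hx (hsupp (support_deriv_subset h))
    rw [this, mul_zero]
  obtain ⟨ip, hp⟩ :=
    integral_measureReal_Iic_mul_deriv μ.toJordanDecomposition.posPart hφ1 hc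
  obtain ⟨im, hm⟩ :=
    integral_measureReal_Iic_mul_deriv μ.toJordanDecomposition.negPart hφ1 hc
  have hd : Integrable (deriv φ) :=
    (hφ1.continuous_deriv le_rfl).integrable_of_hasCompactSupport hc.deriv
  have e : ∀ x, prim k μ x * deriv φ x = k * deriv φ x +
      (μ.toJordanDecomposition.posPart.real (Iic x) * deriv φ x
        - μ.toJordanDecomposition.negPart.real (Iic x) * deriv φ x) := by
    intro x; rw [prim, signedMeasure_eq_jordan μ measurableSet_Iic]; ring
  rw [funext e, integral_add (hd.const_mul k) (by exact ip.sub im), integral_const_mul,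
    integral_deriv_eq_zero hφ1 hc, integral_sub ip im, hp, hm]
  conv_rhs => rw [← SignedMeasure.toSignedMeasure_toJordanDecomposition μ]
  rw [JordanDecomposition.toSignedMeasure, VectorMeasure.integral_sub_vectorMeasure,
    VectorMeasure.integral_toSignedMeasure, VectorMeasure.integral_toSignedMeasure]
  · ring
  all_goals
    rw [VectorMeasure.Integrable, Measure.variation_toSignedMeasure]
    exact hφ.continuous.integrable_of_hasCompactSupport hc

/-! ### Functions with a measure derivative are primitives -/

/-- Du Bois-Reymond's lemma. With `η` a bump of integral one and `m` the integral of a test function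
`ψ`, the difference `ψ - m * η` has integral zero, so it is the derivative of an admissible test
function. Thus `v` integrates against `ψ` as the constant `∫ v * η` does. -/
lemma ae_eq_const_of_integral_mul_deriv_eq_zero {a b : ℝ} (hab : a < b) {v : ℝ → ℝ}
    (hv : IntegrableOn v (Ioo a b))
    (h : ∀ φ : ℝ → ℝ, ContDiff ℝ ∞ φ → HasCompactSupport φ → tsupport φ ⊆ Ioo a b →
      ∫ x in Ioo a b, v x * deriv φ x = 0) :
    ∃ k : ℝ, v =ᵐ[volume.restrict (Ioo a b)] fun _ => k := by
  let B : ContDiffBump ((a + b) / 2) := ⟨(b - a) / 8, (b - a) / 4, by linarith, by linarith⟩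
  set η : ℝ → ℝ := B.normed volume with hη
  have hηs : ContDiff ℝ ∞ η := B.contDiff_normed
  have hηc : HasCompactSupport η := B.hasCompactSupport_normed
  have hηt : tsupport η ⊆ Ioo a b := by
    rw [hη, B.tsupport_normed_eq, Real.closedBall_eq_Icc]
    intro x hx
    have : B.rOut = (b - a) / 4 := rfl
    rw [this] at hx
    exact ⟨by linarith [hx.1], by linarith [hx.2]⟩
  have hη0 : (tsupport η).Nonempty := by
    rw [hη, B.tsupport_normed_eq]
    exact ⟨_, Metric.mem_closedBall_self B.rOut_pos.le⟩
  have hη1 : ∫ x, η x = 1 := B.integral_normed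
  have bddmul : ∀ ψ : ℝ → ℝ, Continuous ψ → HasCompactSupport ψ →
      IntegrableOn (fun x => v x * ψ x) (Ioo a b) := by
    intro ψ hψ hψc
    obtain ⟨c, hc⟩ := hψc.exists_bound_of_continuous hψ
    exact hv.mul_bdd (c := c) hψ.aestronglyMeasurable (Eventually.of_forall hc)
  refine ⟨∫ x in Ioo a b, v x * η x, ?_⟩
  set k := ∫ x in Ioo a b, v x * η x with hk
  have key : ∀ᵐ x ∂(volume.restrict (Ioo a b)), x ∈ Ioo a b → v x - k = 0 := by
    have hvk : IntegrableOn (fun x => v x - k) (Ioo a b) :=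
      Integrable.sub hv (integrableOn_const (by simp))
    refine isOpen_Ioo.ae_eq_zero_of_integral_contDiff_smul_eq_zero
      (IntegrableOn.locallyIntegrableOn (by rwa [IntegrableOn, Measure.restrict_restrict
        measurableSet_Ioo, inter_self])) fun ψ hψ hψc hψt => ?_
    set m := ∫ x, ψ x with hm
    set f : ℝ → ℝ := fun x => ψ x - m * η x with hf
    have hfs : ContDiff ℝ ∞ f := hψ.sub (contDiff_const.mul hηs)
    have hψi : Integrable ψ := hψ.continuous.integrable_of_hasCompactSupport hψc
    have hηi : Integrable η := hηs.continuous.integrable_of_hasCompactSupport hηc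
    have hfi : Integrable f := hψi.sub (hηi.const_mul m)
    have hf0 : ∫ x, f x = 0 := by
      rw [hf, integral_sub hψi (hηi.const_mul m), integral_const_mul, hη1]; ring
    -- The primitive `φ` of `f` vanishes to the left of `T`, where nothing has been integrated yet,
    -- and to the right, where the whole integral of `f`, which is zero, has been collected.
    set T := tsupport ψ ∪ tsupport η with hT
    have hTc : IsCompact T := hψc.union hηc
    have hTn : T.Nonempty := hη0.mono subset_union_right
    have hTs : T ⊆ Ioo a b := union_subset hψt hηt
    have hfT : ∀ x, x ∉ T → f x = 0 := by
      intro x hx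
      rw [hT, mem_union, not_or] at hx
      simp [hf, image_eq_zero_of_notMem_tsupport hx.1, image_eq_zero_of_notMem_tsupport hx.2]
    have hI := hTs (hTc.sInf_mem hTn)
    have hS := hTs (hTc.sSup_mem hTn)
    set φ : ℝ → ℝ := fun x => ∫ y in Iic x, f y with hφ
    have hφd : ∀ x, HasDerivAt φ (f x) x := by
      intro x
      have h1 : φ = fun x => (∫ y in Iic a, f y) + ∫ y in a..x, f y := by
        ext x
        have := intervalIntegral.integral_Iic_sub_Iic (a := a) (b := x) hfi.integrableOn
          hfi.integrableOn
        simp only [hφ]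
        linarith
      rw [h1]
      exact (intervalIntegral.integral_hasDerivAt_right hfi.intervalIntegrable
        hfs.continuous.aestronglyMeasurable.stronglyMeasurableAtFilter
        hfs.continuous.continuousAt).const_add _
    have hφ' : deriv φ = f := funext fun x => (hφd x).deriv
    have hφs : ContDiff ℝ ∞ φ :=
      contDiff_infty_iff_deriv.2 ⟨fun x => (hφd x).differentiableAt, hφ' ▸ hfs⟩
    have hφt : tsupport φ ⊆ Icc (sInf T) (sSup T) := by
      refine closure_minimal (fun x hx => ?_) isClosed_Icc
      by_contra hx'
      rw [mem_Icc, not_and_or, not_le, not_le] at hx'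
      refine hx ?_
      rcases hx' with hx' | hx'
      · refine setIntegral_eq_zero_of_forall_eq_zero fun y hy => hfT y fun hyT => ?_
        exact (csInf_le hTc.bddBelow hyT).not_gt (lt_of_le_of_lt hy hx')
      · rw [hφ]
        simp only
        rw [setIntegral_eq_integral_of_forall_compl_eq_zero, hf0]
        intro y hy
        refine hfT y fun hyT => hy ?_
        exact (le_csSup hTc.bddAbove hyT).trans hx'.le
    have h0 := h φ hφs (HasCompactSupport.of_support_subset_isCompact isCompact_Icc
      (subset_closure.trans hφt)) (hφt.trans (Icc_subset_Ioo hI.1 hS.2))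
    rw [hφ'] at h0
    have e1 : ∀ x, v x * f x = v x * ψ x - m * (v x * η x) := fun x => by rw [hf]; ring
    rw [funext e1, integral_sub (bddmul ψ hψ.continuous hψc)
      ((bddmul η hηs.continuous hηc).const_mul m), integral_const_mul, ← hk] at h0
    have e2 : ∀ x, ψ x • (v x - k) = v x * ψ x - k * ψ x := fun x => by
      rw [smul_eq_mul]; ring
    have e3 : ∫ x in Ioo a b, ψ x = m :=
      setIntegral_eq_integral_of_forall_compl_eq_zero fun x hx =>
        image_eq_zero_of_notMem_tsupport fun h => hx (hψt h)
    rw [funext e2, integral_sub (bddmul ψ hψ.continuous hψc) (hψi.integrableOn.const_mul k),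
      integral_const_mul, e3]
    linarith
  filter_upwards [key, ae_restrict_mem measurableSet_Ioo] with x hx hx'
  exact sub_eq_zero.1 (hx hx')

/-- A function with distributional derivative `D` is a primitive of `D`. -/
theorem IsDistribDeriv.exists_ae_eq_prim {a b : ℝ} (hab : a < b) {u : ℝ → ℝ}
    {D : SignedMeasure ℝ} (hD : IsDistribDeriv a b u D) (hu : IntegrableOn u (Ioo a b)) :
    ∃ k : ℝ, u =ᵐ[volume.restrict (Ioo a b)] prim k D := by
  obtain ⟨k, hk⟩ := ae_eq_const_of_integral_mul_deriv_eq_zero hab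
    (hu.sub (integrableOn_prim a b 0 D)) fun φ hφ hc ht => by
      have hφ1 : ContDiff ℝ 1 φ := hφ.of_le (by exact_mod_cast le_top)
      have hd : Continuous (deriv φ) := hφ1.continuous_deriv le_rfl
      obtain ⟨c, hcb⟩ := hc.deriv.exists_bound_of_continuous hd
      have e : ∀ x, (u - prim 0 D) x * deriv φ x = u x * deriv φ x - prim 0 D x * deriv φ x :=
        fun x => by rw [Pi.sub_apply]; ring
      rw [funext e, integral_sub
        (hu.mul_bdd (c := c) hd.aestronglyMeasurable (Eventually.of_forall hcb))
        ((integrableOn_prim a b 0 D).mul_bdd (c := c) hd.aestronglyMeasurable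
          (Eventually.of_forall hcb)), hD φ hφ hc ht, isDistribDeriv_prim a b 0 D φ hφ hc ht,
        sub_self]
  refine ⟨k, ?_⟩
  filter_upwards [hk] with x hx
  rw [Pi.sub_apply, prim, zero_add] at hx
  rw [prim]; linarith

/-! ### Traces and jumps of functions with one-sided limits -/

lemma isLeftTrace_of_tendsto {a b x p : ℝ} {u f : ℝ → ℝ}
    (h : u =ᵐ[volume.restrict (Ioo a b)] f) (hx : x ∈ Ioo a b)
    (hf : Tendsto f (𝓝[<] x) (𝓝 p)) : IsLeftTrace u x p := by
  rw [IsLeftTrace, Metric.tendsto_nhds]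
  intro ε hε
  have h1 : ∀ᶠ y in 𝓝[<] x, |f y - p| < ε / 2 := by
    have := Metric.tendsto_nhds.1 hf (ε / 2) (by positivity)
    simpa only [Real.dist_eq] using this
  obtain ⟨l, hl, hl'⟩ := (mem_nhdsLT_iff_exists_Ioo_subset).1 h1
  have hl : l < x := hl
  filter_upwards [Ioo_mem_nhdsGT (lt_min (sub_pos.2 hx.1) (sub_pos.2 hl))] with r hr
  have hr1 := hr.2.trans_le (min_le_left _ _)
  have hr2 := hr.2.trans_le (min_le_right _ _)
  have hsub : Ioo (x - r) x ⊆ Ioo a b := Ioo_subset_Ioo (by linarith) hx.2.le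
  have hb : ‖∫ y in Ioo (x - r) x, |u y - p|‖ ≤ ε / 2 * volume.real (Ioo (x - r) x) := by
    refine norm_setIntegral_le_of_norm_le_const_ae (by simp) ?_
    filter_upwards [ae_restrict_of_ae_restrict_of_subset hsub h,
      ae_restrict_mem measurableSet_Ioo] with y hy hy'
    rw [hy, Real.norm_eq_abs, abs_abs]
    exact (hl' ⟨by linarith [hy'.1], hy'.2⟩ : |f y - p| < ε / 2).le
  have hv : volume.real (Ioo (x - r) x) = r := by
    rw [Real.volume_real_Ioo_of_le (by linarith [hr.1])]; ring
  rw [Real.dist_0_eq_abs, abs_mul, abs_inv, abs_of_pos hr.1]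
  rw [hv, Real.norm_eq_abs] at hb
  calc r⁻¹ * _ ≤ r⁻¹ * (ε / 2 * r) := by gcongr; exact inv_nonneg.2 hr.1.le
    _ = ε / 2 := by field_simp [hr.1.ne']
    _ < ε := by linarith

lemma isRightTrace_of_tendsto {a b x p : ℝ} {u f : ℝ → ℝ}
    (h : u =ᵐ[volume.restrict (Ioo a b)] f) (hx : x ∈ Ioo a b)
    (hf : Tendsto f (𝓝[>] x) (𝓝 p)) : IsRightTrace u x p := by
  rw [IsRightTrace, Metric.tendsto_nhds]
  intro ε hε
  have h1 : ∀ᶠ y in 𝓝[>] x, |f y - p| < ε / 2 := by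
    have := Metric.tendsto_nhds.1 hf (ε / 2) (by positivity)
    simpa only [Real.dist_eq] using this
  obtain ⟨l, hl, hl'⟩ := (mem_nhdsGT_iff_exists_Ioo_subset).1 h1
  have hl : x < l := hl
  filter_upwards [Ioo_mem_nhdsGT (lt_min (sub_pos.2 hx.2) (sub_pos.2 hl))] with r hr
  have hr1 := hr.2.trans_le (min_le_left _ _)
  have hr2 := hr.2.trans_le (min_le_right _ _)
  have hsub : Ioo x (x + r) ⊆ Ioo a b := Ioo_subset_Ioo hx.1.le (by linarith)
  have hb : ‖∫ y in Ioo x (x + r), |u y - p|‖ ≤ ε / 2 * volume.real (Ioo x (x + r)) := by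
    refine norm_setIntegral_le_of_norm_le_const_ae (by simp) ?_
    filter_upwards [ae_restrict_of_ae_restrict_of_subset hsub h,
      ae_restrict_mem measurableSet_Ioo] with y hy hy'
    rw [hy, Real.norm_eq_abs, abs_abs]
    exact (hl' ⟨hy'.1, by linarith [hy'.2]⟩ : |f y - p| < ε / 2).le
  have hv : volume.real (Ioo x (x + r)) = r := by
    rw [Real.volume_real_Ioo_of_le (by linarith [hr.1])]; ring
  rw [Real.dist_0_eq_abs, abs_mul, abs_inv, abs_of_pos hr.1]
  rw [hv, Real.norm_eq_abs] at hb
  calc r⁻¹ * _ ≤ r⁻¹ * (ε / 2 * r) := by gcongr; exact inv_nonneg.2 hr.1.le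
    _ = ε / 2 := by field_simp [hr.1.ne']
    _ < ε := by linarith

lemma leftTrace_eq {a b x p : ℝ} {u : ℝ → ℝ} (hu : IntegrableOn u (Ioo a b)) (hx : x ∈ Ioo a b)
    (hp : IsLeftTrace u x p) : leftTrace u x = p :=
  IsLeftTrace.unique hu hx (Classical.epsilon_spec ⟨p, hp⟩) hp

lemma rightTrace_eq {a b x p : ℝ} {u : ℝ → ℝ} (hu : IntegrableOn u (Ioo a b)) (hx : x ∈ Ioo a b)
    (hp : IsRightTrace u x p) : rightTrace u x = p :=
  IsRightTrace.unique hu hx (Classical.epsilon_spec ⟨p, hp⟩) hp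

/-- The one-sided limits of the primitive at `x` are its traces, and they differ by exactly `μ {x}`.
-/
lemma jumpSet_eq {a b k : ℝ} {u : ℝ → ℝ} {μ : SignedMeasure ℝ} (hu : IntegrableOn u (Ioo a b))
    (h : u =ᵐ[volume.restrict (Ioo a b)] prim k μ) :
    jumpSet a b u = Ioo a b ∩ {x | μ {x} ≠ 0} := by
  ext x
  simp only [jumpSet, mem_ofPred_eq, mem_inter_iff]
  refine and_congr_right fun hx => ?_
  have hl := isLeftTrace_of_tendsto h hx (tendsto_prim_left k μ x)
  have hr := isRightTrace_of_tendsto h hx (tendsto_prim_right k μ x)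
  have e := primLeft_add_singleton k μ x
  constructor
  · rintro ⟨p, q, hpq, hp, hq⟩ h0
    rw [IsLeftTrace.unique hu hx hp hl, IsRightTrace.unique hu hx hq hr] at hpq
    exact hpq (by rw [← e, h0, add_zero])
  · intro h0
    exact ⟨_, _, fun h' => h0 (by linarith), hl, hr⟩

lemma jumpSize_eq {a b k x : ℝ} {u : ℝ → ℝ} {μ : SignedMeasure ℝ} (hu : IntegrableOn u (Ioo a b))
    (h : u =ᵐ[volume.restrict (Ioo a b)] prim k μ) (hx : x ∈ Ioo a b) :
    jumpSize u x = ‖μ {x}‖₊ := by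
  rw [jumpSize, leftTrace_eq hu hx (isLeftTrace_of_tendsto h hx (tendsto_prim_left k μ x)),
    rightTrace_eq hu hx (isRightTrace_of_tendsto h hx (tendsto_prim_right k μ x)),
    nndist_comm, nndist_eq_nnnorm, ← primLeft_add_singleton k μ x, add_sub_cancel_left]

/-! ### Jump costs -/

lemma Admissible.add_le {K : ℝ≥0 → ℝ≥0} (hK : Admissible K) (r s : ℝ≥0) :
    K (r + s) ≤ K r + K s := by
  -- The extra `1` keeps the size bound positive when `r = s = 0`.
  obtain ⟨C, hC, h⟩ := hK.subadd (r + s + 1) (by positivity)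
  have := h r s (by linarith)
  have h0 : 0 ≤ C * r * s := by positivity
  have : (K (r + s) : ℝ) ≤ K r + K s := by linarith
  exact_mod_cast this

lemma Admissible.nsmul_le {K : ℝ≥0 → ℝ≥0} (hK : Admissible K) (n : ℕ) (r : ℝ≥0) :
    K (n * r) ≤ n * K r := by
  induction n with
  | zero => simp [hK.map_zero]
  | succ n ih =>
    push_cast
    rw [add_mul, add_mul, one_mul, one_mul]
    exact (hK.add_le _ _).trans (add_le_add_left ih _)

/-- Subadditivity gives `K r ≤ n * K (r / n)`, and the unit slope at zero sends the right side to
`r`. This is why diffuse variation costs at least as much as a jump of the same size. -/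
lemma Admissible.le_self {K : ℝ≥0 → ℝ≥0} (hK : Admissible K) (r : ℝ≥0) : K r ≤ r := by
  rcases eq_or_ne r 0 with rfl | hr
  · simp [hK.map_zero]
  have hr0 : 0 < r := pos_iff_ne_zero.2 hr
  have ht : Tendsto (fun n : ℕ => r / ((n : ℝ≥0) + 1)) atTop (𝓝[>] 0) := by
    refine tendsto_nhdsWithin_iff.2 ⟨?_, Eventually.of_forall fun n => ?_⟩
    · have := (tendsto_one_div_add_atTop_nhds_zero_nat (𝕜 := ℝ≥0)).const_mul r
      simpa [div_eq_mul_inv] using this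
    · exact div_pos hr0 (by positivity)
  have h1 := (hK.slope.comp ht).const_mul r
  rw [mul_one] at h1
  refine ge_of_tendsto' h1 fun n => ?_
  have hn : ((n : ℝ≥0) + 1) ≠ 0 := by positivity
  have h2 := hK.nsmul_le (n + 1) (r / ((n : ℝ≥0) + 1))
  push_cast at h2
  rw [mul_div_cancel₀ _ hn] at h2
  refine h2.trans (le_of_eq ?_)
  simp only [Function.comp]
  field_simp

lemma Admissible.nnnorm_add_le {K : ℝ≥0 → ℝ≥0} (hK : Admissible K) (r s : ℝ) :
    K ‖r + s‖₊ ≤ K ‖r‖₊ + K ‖s‖₊ :=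
  (hK.mono (_root_.nnnorm_add_le r s)).trans (hK.add_le _ _)

lemma Admissible.nnnorm_sum_le {K : ℝ≥0 → ℝ≥0} (hK : Admissible K) {ι : Type*} (F : Finset ι)
    (f : ι → ℝ) : K ‖∑ i ∈ F, f i‖₊ ≤ ∑ i ∈ F, K ‖f i‖₊ := by
  classical
  induction F using Finset.induction_on with
  | empty => simp [hK.map_zero]
  | insert i F hi ih =>
    rw [Finset.sum_insert hi, Finset.sum_insert hi]
    exact (hK.nnnorm_add_le _ _).trans (add_le_add_right ih _)

/-- Lower semicontinuity carries finite subadditivity over to infinitely many jumps. -/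
lemma Admissible.nnnorm_le_tsum {K : ℝ≥0 → ℝ≥0} (hK : Admissible K) {ι : Type*} {f : ι → ℝ}
    {S : ℝ} (hf : HasSum f S) : (K ‖S‖₊ : ℝ≥0∞) ≤ ∑' i, (K ‖f i‖₊ : ℝ≥0∞) := by
  by_contra! hlt
  obtain ⟨T, hT⟩ := WithTop.ne_top_iff_exists.1 (hlt.trans_le le_top).ne
  change (T : ℝ≥0∞) = _ at hT
  rw [← hT, ENNReal.coe_lt_coe] at hlt
  have hev := (continuous_nnnorm.tendsto S).comp hf
  obtain ⟨F, hF⟩ := (hev.eventually (hK.lsc _ T hlt)).exists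
  have h1 := hF.trans_le (hK.nnnorm_sum_le F f)
  have h2 : ((∑ i ∈ F, K ‖f i‖₊ : ℝ≥0) : ℝ≥0∞) ≤ T := by
    rw [hT, ENNReal.ofNNReal_finsetSum]
    exact ENNReal.sum_le_tsum F
  exact (ENNReal.coe_lt_coe.2 h1).not_ge h2

/-! ### The jump-weighted variation of a signed measure -/

lemma countable_atoms (μ : SignedMeasure ℝ) : {x | μ {x} ≠ 0}.Countable := by
  refine (Measure.countable_meas_pos_of_disjoint_iUnion (μ := μ.variation)
    (As := fun x : ℝ => {x}) (fun x => measurableSet_singleton x)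
    (fun x y hxy => disjoint_singleton.2 hxy)).mono fun x hx => ?_
  refine pos_iff_ne_zero.2 fun h : μ.variation {x} = 0 => hx ?_
  exact (VectorMeasure.variation_apply_eq_zero (measurableSet_singleton x)).1 h _ subset_rfl
    (measurableSet_singleton x)

lemma measurableSet_nonatoms (μ : SignedMeasure ℝ) : MeasurableSet {x | μ {x} = 0} := by
  have : {x | μ {x} = 0} = {x | μ {x} ≠ 0}ᶜ := by ext; simp
  rw [this]
  exact (countable_atoms μ).measurableSet.compl

/-- The variation of `μ` where every atom of mass `m` is charged `K |m|` instead of `|m|`. -/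
noncomputable def kvar (K : ℝ≥0 → ℝ≥0) (μ : SignedMeasure ℝ) : Measure ℝ :=
  μ.variation.restrict {x | μ {x} = 0}
    + Measure.sum fun x => (K ‖μ {x}‖₊ : ℝ≥0∞) • Measure.dirac x

lemma kvar_apply (K : ℝ≥0 → ℝ≥0) (μ : SignedMeasure ℝ) {E : Set ℝ} (hE : MeasurableSet E) :
    kvar K μ E = μ.variation (E ∩ {x | μ {x} = 0})
      + ∑' x, E.indicator (fun x => (K ‖μ {x}‖₊ : ℝ≥0∞)) x := by
  rw [kvar, Measure.add_apply, Measure.restrict_apply hE, Measure.sum_apply _ hE]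
  congr 2
  ext x
  by_cases hx : x ∈ E <;> simp [hE, hx]

lemma kvar_congr (K : ℝ≥0 → ℝ≥0) {μ ν : SignedMeasure ℝ} {E : Set ℝ} (hE : MeasurableSet E)
    (h : ∀ t ⊆ E, MeasurableSet t → μ t = ν t) : kvar K μ E = kvar K ν E := by
  have hr : μ.restrict E = ν.restrict E := by
    ext t ht
    rw [VectorMeasure.restrict_apply _ hE ht, VectorMeasure.restrict_apply _ hE ht]
    exact h _ inter_subset_right (ht.inter hE)
  have hx : ∀ x ∈ E, μ {x} = ν {x} := fun x hx =>
    h _ (singleton_subset_iff.2 hx) (measurableSet_singleton x)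
  have hs : E ∩ {x | μ {x} = 0} = E ∩ {x | ν {x} = 0} := by
    ext x
    exact and_congr_right fun hxE => by simp [hx x hxE]
  rw [kvar_apply K μ hE, kvar_apply K ν hE, hs]
  congr 1
  · have h1 : ∀ μ : SignedMeasure ℝ, μ.variation (E ∩ {x | ν {x} = 0}) =
        (μ.restrict E).variation {x | ν {x} = 0} := fun μ => by
      rw [VectorMeasure.variation_restrict hE, Measure.restrict_apply (measurableSet_nonatoms ν),
        inter_comm]
    rw [h1, h1, hr]
  · congr 1
    ext x
    by_cases hxE : x ∈ E <;> simp [hxE, hx]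

lemma kvar_eq_zero {K : ℝ≥0 → ℝ≥0} (hK : K 0 = 0) {μ : SignedMeasure ℝ} {E : Set ℝ}
    (hE : MeasurableSet E) (h : ∀ t ⊆ E, MeasurableSet t → μ t = 0) : kvar K μ E = 0 := by
  rw [kvar_congr K (ν := 0) hE (by simpa using h), kvar_apply K 0 hE]
  simp [hK]

lemma kvar_singleton (K : ℝ≥0 → ℝ≥0) (μ : SignedMeasure ℝ) (x : ℝ) :
    kvar K μ {x} = K ‖μ {x}‖₊ := by
  rw [kvar_apply K μ (measurableSet_singleton x), tsum_eq_single x, indicator_of_mem (mem_singleton x),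
    (VectorMeasure.variation_apply_eq_zero ((measurableSet_singleton x).inter
      (measurableSet_nonatoms μ))).2, zero_add]
  · intro t ht _
    rcases subset_singleton_iff_eq.1 (ht.trans inter_subset_left) with rfl | rfl
    · simp
    · exact (ht rfl).2
  · intro y hy
    rw [indicator_of_notMem (by simpa using hy)]

/-- Concentrating all the mass of `E` in one jump never raises the cost. The non-atomic part is
handled by `K r ≤ r`, the countably many atoms by `nnnorm_le_tsum`. -/
lemma Admissible.le_kvar {K : ℝ≥0 → ℝ≥0} (hK : Admissible K) (μ : SignedMeasure ℝ) {E : Set ℝ}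
    (hE : MeasurableSet E) : (K ‖μ E‖₊ : ℝ≥0∞) ≤ kvar K μ E := by
  have hm := measurableSet_nonatoms μ
  have hc : (E \ {x | μ {x} = 0}).Countable :=
    (countable_atoms μ).mono fun x hx => hx.2
  have e : μ E = μ (E ∩ {x | μ {x} = 0}) + μ (E \ {x | μ {x} = 0}) := by
    rw [← VectorMeasure.of_union (disjoint_sdiff_inter.symm) (hE.inter hm) (hE.diff hm),
      inter_union_sdiff]
  rw [e, kvar_apply K μ hE]
  refine (ENNReal.coe_le_coe.2 (hK.nnnorm_add_le _ _)).trans ?_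
  rw [ENNReal.coe_add]
  refine add_le_add ?_ ?_
  · refine (ENNReal.coe_le_coe.2 (hK.le_self _)).trans ?_
    exact VectorMeasure.enorm_measure_le_variation μ _
  · have hu : E \ {x | μ {x} = 0} = ⋃ x : ↥(E \ {x | μ {x} = 0}), {(x : ℝ)} :=
      (iUnion_of_singleton_coe _).symm
    have : Countable ↥(E \ {x | μ {x} = 0}) := hc.to_subtype
    have hs : HasSum (fun x : ↥(E \ {x | μ {x} = 0}) => μ {(x : ℝ)}) (μ (E \ {x | μ {x} = 0})) := by
      conv => arg 2; rw [hu]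
      refine VectorMeasure.hasSum_of_disjoint_iUnion (fun i => measurableSet_singleton _) ?_
      intro x y hxy
      exact disjoint_singleton.2 fun h => hxy (Subtype.ext h)
    refine (hK.nnnorm_le_tsum hs).trans ?_
    rw [tsum_subtype (E \ {x | μ {x} = 0}) fun x => (K ‖μ {x}‖₊ : ℝ≥0∞)]
    exact ENNReal.tsum_le_tsum fun x => indicator_le_indicator_of_subset sdiff_subset
      (fun _ => zero_le) x

/-- The first part of the energy only depends on the derivative. -/
lemma TVK_eq_kvar {K : ℝ≥0 → ℝ≥0} (hK : K 0 = 0) {a b : ℝ} (hab : a < b) {u : ℝ → ℝ} {D : SignedMeasure ℝ}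
    (hu : IntegrableOn u (Ioo a b)) (hD : IsDistribDeriv a b u D) :
    TVK K a b u = kvar K D (Ioo a b) := by
  have hD' := MemBV.isDistribDeriv ⟨hu, D, hD⟩
  obtain ⟨k, hk⟩ := hD'.exists_ae_eq_prim hab hu
  have hr := hD'.restrict_eq hD
  rw [← kvar_congr K (μ := distribDeriv a b u) measurableSet_Ioo fun t ht htm => by
    rw [← VectorMeasure.restrict_eq_self _ measurableSet_Ioo htm ht, hr,
      VectorMeasure.restrict_eq_self _ measurableSet_Ioo htm ht]]
  set D' := distribDeriv a b u with hD'
  rw [TVK, ← hD', kvar_apply K D' measurableSet_Ioo, tsum_subtype (jumpSet a b u)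
    fun x => (K (jumpSize u x) : ℝ≥0∞), jumpSet_eq hu hk]
  congr 2
  · ext x
    simp only [Set.mem_sdiff, mem_inter_iff, mem_ofPred_eq]
    tauto
  · ext x
    by_cases hx : x ∈ Ioo a b
    · by_cases h0 : D' {x} = 0
      · simp [h0, hK, indicator]
      · simp [h0, hx, jumpSize_eq hu hk hx]
    · simp [hx]

/-! ### Minimality in terms of primitives -/

/-- The primitive `prim k μ` minimizes the energy among all primitives of signed measures. -/
structure IsMinPrim (K : ℝ≥0 → ℝ≥0) (lam a b : ℝ) (g : ℝ → ℝ) (k : ℝ) (μ : SignedMeasure ℝ) :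
    Prop where
  lt_top : kvar K μ (Ioo a b) + fidelity lam a b g (prim k μ) < ⊤
  le : ∀ k' μ', kvar K μ (Ioo a b) + fidelity lam a b g (prim k μ) ≤
    kvar K μ' (Ioo a b) + fidelity lam a b g (prim k' μ')

lemma fidelity_congr (lam a b : ℝ) (g : ℝ → ℝ) {u v : ℝ → ℝ}
    (h : u =ᵐ[volume.restrict (Ioo a b)] v) : fidelity lam a b g u = fidelity lam a b g v := by
  rw [fidelity, fidelity]
  congr 1
  refine lintegral_congr_ae ?_
  filter_upwards [h] with x hx
  rw [hx]

lemma TVKg_eq {K : ℝ≥0 → ℝ≥0} (hK : K 0 = 0) (lam : ℝ) {a b : ℝ} (hab : a < b) (g : ℝ → ℝ)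
    {u : ℝ → ℝ} {k : ℝ} {D : SignedMeasure ℝ} (hu : IntegrableOn u (Ioo a b))
    (hD : IsDistribDeriv a b u D) (h : u =ᵐ[volume.restrict (Ioo a b)] prim k D) :
    TVKg K lam a b g u = kvar K D (Ioo a b) + fidelity lam a b g (prim k D) := by
  rw [TVKg, TVK_eq_kvar hK hab hu hD, fidelity_congr lam a b g h]

/-- A minimizer over `BV(a, b)` is a minimizing primitive, for a measure without mass outside
`(a, b)`. -/
lemma IsMinimizer.exists_isMinPrim {K : ℝ≥0 → ℝ≥0} (hK : K 0 = 0) {lam a b : ℝ} (hab : a < b)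
    {g U : ℝ → ℝ} (hg : MemLp g ⊤ (volume.restrict (Ioo a b))) (hU : IsMinimizer K lam a b g U) :
    ∃ k μ, U =ᵐ[volume.restrict (Ioo a b)] prim k μ ∧ IsMinPrim K lam a b g k μ ∧ μ {b} = 0 := by
  obtain ⟨⟨hi, D, hD⟩, hmin⟩ := hU
  obtain ⟨k, hk⟩ := hD.exists_ae_eq_prim hab hi
  -- The mass of `D` up to `a` goes into the additive constant. Restricting `D` to `(a, b)` removes
  -- any atom at `b`, so the primitive will be left-continuous there.
  have hk' : U =ᵐ[volume.restrict (Ioo a b)] prim (k + D (Iic a)) (D.restrict (Ioo a b)) := by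
    filter_upwards [hk, ae_restrict_mem measurableSet_Ioo] with x hx hx'
    rw [hx, ← prim_add_Ioc k D hx'.1.le, prim, prim, VectorMeasure.restrict_apply _
      measurableSet_Ioo measurableSet_Iic]
    congr 2
    ext y
    simp only [mem_Ioc, mem_inter_iff, mem_Iic, mem_Ioo]
    exact ⟨fun h => ⟨h.2, h.1, h.2.trans_lt hx'.2⟩, fun h => ⟨h.2.1, h.1⟩⟩
  set μ := D.restrict (Ioo a b) with hμ
  have hint : ∀ φ : ℝ → ℝ, ∫ x in Ioo a b, U x * φ x =
      ∫ x in Ioo a b, prim (k + D (Iic a)) μ x * φ x := fun φ => by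
    refine integral_congr_ae ?_
    filter_upwards [hk'] with x hx
    rw [hx]
  have hDμ : IsDistribDeriv a b U μ := fun φ hφ hc ht => by
    rw [hint, isDistribDeriv_prim a b _ μ φ hφ hc ht]
  refine ⟨_, μ, hk', ?_, ?_⟩
  · have hle : ∀ k' μ', kvar K μ (Ioo a b) + fidelity lam a b g (prim (k + D (Iic a)) μ) ≤
        kvar K μ' (Ioo a b) + fidelity lam a b g (prim k' μ') := fun k' μ' => by
      rw [← TVKg_eq hK lam hab g hi hDμ hk', ← TVKg_eq hK lam hab g (integrableOn_prim a b k' μ')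
        (isDistribDeriv_prim a b k' μ') (ae_eq_refl _)]
      exact hmin _ ⟨integrableOn_prim a b k' μ', μ', isDistribDeriv_prim a b k' μ'⟩
    -- The zero function has finite energy, because `g` is square integrable on the bounded
    -- interval.
    refine ⟨(hle 0 0).trans_lt ?_, hle⟩
    rw [kvar_eq_zero hK measurableSet_Ioo fun t _ _ => rfl, zero_add, fidelity]
    refine ENNReal.mul_lt_top ENNReal.ofReal_lt_top ?_
    have h2 : MemLp g 2 (volume.restrict (Ioo a b)) := hg.mono_exponent le_top
    have h3 := h2.integrable_sq.lintegral_lt_top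
    refine lt_of_le_of_lt (lintegral_mono fun x => ?_) h3
    simp [prim]
  · rw [hμ, VectorMeasure.restrict_apply _ measurableSet_Ioo (measurableSet_singleton b)]
    simp

/-- Equal mass on `[s, t]` is what makes the two primitives meet again to the right of `t`. -/
lemma prim_eq_of_agree {k s t : ℝ} (hst : s ≤ t) {μ μ' : SignedMeasure ℝ}
    (h : ∀ T ⊆ (Icc s t)ᶜ, MeasurableSet T → μ' T = μ T) (h0 : μ' (Icc s t) = μ (Icc s t)) :
    primLeft k μ' s = primLeft k μ s ∧ ∀ x ∉ Icc s t, prim k μ' x = prim k μ x := by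
  have hl : primLeft k μ' s = primLeft k μ s := by
    rw [primLeft, primLeft, h _ (fun y hy hy' => hy.not_ge hy'.1) measurableSet_Iio]
  refine ⟨hl, fun x hx => ?_⟩
  rcases lt_or_ge x s with hxs | hxs
  · rw [prim, prim, h (Iic x) (fun y hy hy' => (lt_of_le_of_lt hy hxs).not_ge hy'.1)
      measurableSet_Iic]
  · have hxt : t < x := not_le.1 fun h => hx ⟨hxs, h⟩
    rw [← prim_add_Ioc k μ' hxt.le, ← prim_add_Ioc k μ hxt.le, ← primLeft_add_Icc k μ' hst,
      ← primLeft_add_Icc k μ hst, hl, h0, h _ (fun y hy hy' => hy.1.not_ge hy'.2) measurableSet_Ioc]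

/-- Comparison of a minimizing primitive with one that differs from it only on `[s, t]`. -/
lemma IsMinPrim.local_le {K : ℝ≥0 → ℝ≥0} {lam a b : ℝ} {g : ℝ → ℝ} {k : ℝ} {μ : SignedMeasure ℝ}
    (hm : IsMinPrim K lam a b g k μ) {s t : ℝ} (has : a ≤ s) (hst : s < t) (htb : t ≤ b)
    {μ' : SignedMeasure ℝ} (h : ∀ T ⊆ (Icc s t)ᶜ, MeasurableSet T → μ' T = μ T)
    (h0 : μ' (Icc s t) = μ (Icc s t)) :
    kvar K μ (Ioo a b ∩ Icc s t) + fidelity lam s t g (prim k μ) ≤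
      kvar K μ' (Ioo a b ∩ Icc s t) + fidelity lam s t g (prim k μ') := by
  have hsplit : ∀ u : ℝ → ℝ, fidelity lam a b g u = fidelity lam s t g u +
      ENNReal.ofReal (lam / 2) *
        ∫⁻ x in Ioo a b \ Icc s t, ENNReal.ofReal ((u x - g x) ^ 2) := fun u => by
    rw [fidelity, fidelity, ← mul_add, ← lintegral_inter_add_sdiff _ (Ioo a b)
      (measurableSet_Icc (a := s) (b := t))]
    congr 2
    refine setLIntegral_congr ?_
    have h1 : (Ioo a b ∩ Icc s t : Set ℝ) =ᵐ[volume] (Ioo a b ∩ Ioo s t : Set ℝ) :=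
      (ae_eq_refl _).inter Ioo_ae_eq_Icc.symm
    rwa [inter_eq_right.2 (Ioo_subset_Ioo has htb)] at h1
  have hout : ∫⁻ x in Ioo a b \ Icc s t, ENNReal.ofReal ((prim k μ' x - g x) ^ 2) =
      ∫⁻ x in Ioo a b \ Icc s t, ENNReal.ofReal ((prim k μ x - g x) ^ 2) :=
    setLIntegral_congr_fun (measurableSet_Ioo.diff measurableSet_Icc) fun x hx => by
      rw [(prim_eq_of_agree hst.le h h0).2 x hx.2]
  have hkout : kvar K μ' (Ioo a b \ Icc s t) = kvar K μ (Ioo a b \ Icc s t) :=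
    kvar_congr K (measurableSet_Ioo.diff measurableSet_Icc) fun T hT hTm =>
      h T (fun x hx => (hT hx).2) hTm
  have hle := hm.le k μ'
  have hfin := hm.lt_top
  rw [hsplit, ← measure_inter_add_sdiff (μ := kvar K μ) (Ioo a b)
    (measurableSet_Icc (a := s) (b := t))] at hle hfin
  rw [hsplit, ← measure_inter_add_sdiff (μ := kvar K μ') (Ioo a b)
    (measurableSet_Icc (a := s) (b := t)), hkout, hout,
    add_add_add_comm (kvar K μ _), add_add_add_comm (kvar K μ' _)] at hle
  rw [add_add_add_comm] at hfin
  -- The contributions outside `[s, t]` coincide, and finiteness of the energy allows cancelling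
  -- them in `ℝ≥0∞`.
  exact (ENNReal.add_le_add_iff_right (ENNReal.add_ne_top.1 hfin.ne).2).1 hle

lemma IsMinPrim.local_lt_top {K : ℝ≥0 → ℝ≥0} {lam a b : ℝ} {g : ℝ → ℝ} {k : ℝ}
    {μ : SignedMeasure ℝ} (hm : IsMinPrim K lam a b g k μ) {s t : ℝ} (has : a ≤ s) (htb : t ≤ b) :
    kvar K μ (Ioo a b) < ⊤ ∧ fidelity lam s t g (prim k μ) < ⊤ := by
  obtain ⟨h1, h2⟩ := ENNReal.add_lt_top.1 hm.lt_top
  refine ⟨h1, lt_of_le_of_lt ?_ h2⟩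
  rw [fidelity, fidelity]
  gcongr

/-! ### Replacing a measure by point masses on an interval -/

/-- The measure `μ` with its part on `[s, t]` replaced by masses `v` at `p` and `w` at `t`. -/
noncomputable def bridge (μ : SignedMeasure ℝ) (s t p v w : ℝ) : SignedMeasure ℝ :=
  μ.restrict (Icc s t)ᶜ + (VectorMeasure.dirac p v + VectorMeasure.dirac t w)

open scoped Classical in
lemma bridge_apply (μ : SignedMeasure ℝ) (s t p v w : ℝ) {T : Set ℝ} (hT : MeasurableSet T) :
    bridge μ s t p v w T = μ (T ∩ (Icc s t)ᶜ) + ((if p ∈ T then v else 0) +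
      (if t ∈ T then w else 0)) := by
  have hd : ∀ x m : ℝ, (VectorMeasure.dirac x m : SignedMeasure ℝ) T = if x ∈ T then m else 0 := by
    intro x m
    split_ifs with h
    · rw [VectorMeasure.dirac_apply_of_mem hT h]
    · rw [VectorMeasure.dirac_apply_of_notMem h]
  rw [bridge, _root_.add_apply, _root_.add_apply, hd, hd,
    VectorMeasure.restrict_apply _ measurableSet_Icc.compl hT]

lemma bridge_agree (μ : SignedMeasure ℝ) {s t p : ℝ} (hp : p ∈ Icc s t) (v w : ℝ) {T : Set ℝ}
    (hT : T ⊆ (Icc s t)ᶜ) (hTm : MeasurableSet T) : bridge μ s t p v w T = μ T := by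
  rw [bridge_apply _ _ _ _ _ _ hTm, inter_eq_left.2 hT, if_neg fun h => hT h hp,
    if_neg fun h => hT h ⟨hp.1.trans hp.2, le_rfl⟩]
  simp

lemma bridge_Icc (μ : SignedMeasure ℝ) {s t p : ℝ} (hp : p ∈ Icc s t) (v w : ℝ) :
    bridge μ s t p v w (Icc s t) = v + w := by
  rw [bridge_apply _ _ _ _ _ _ measurableSet_Icc, inter_compl_self, if_pos hp,
    if_pos ⟨hp.1.trans hp.2, le_rfl⟩]
  simp

open scoped Classical in
lemma prim_bridge (k : ℝ) (μ : SignedMeasure ℝ) {s t p x : ℝ} (hp : p ∈ Icc s t)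
    (v w : ℝ) (hx : x ∈ Ioo s t) :
    prim k (bridge μ s t p v w) x = primLeft k μ s + if p ≤ x then v else 0 := by
  have e : primLeft k (bridge μ s t p v w) s = primLeft k μ s := by
    rw [primLeft, primLeft, bridge_agree μ hp v w (fun y hy hy' => hy.not_ge hy'.1)
      measurableSet_Iio]
  have hI : Icc s x ∩ (Icc s t)ᶜ = ∅ := by
    rw [← disjoint_iff_inter_eq_empty, disjoint_compl_right_iff_subset]
    exact Icc_subset_Icc_right hx.2.le
  rw [← primLeft_add_Icc k _ hx.1.le, e, bridge_apply _ _ _ _ _ _ measurableSet_Icc, hI,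
    VectorMeasure.empty, zero_add, if_neg (c := t ∈ Icc s x) fun h => hx.2.not_ge h.2, add_zero]
  congr 1
  simp [hp.1]

open scoped Classical in
-- Only an inequality: when `p = t` the two masses merge and subadditivity is used. The set `E` will
-- be `(a, b)`, so that masses placed at `a` or `b` are free.
lemma kvar_bridge_le {K : ℝ≥0 → ℝ≥0} (hK : Admissible K) (μ : SignedMeasure ℝ) {s t p : ℝ}
    (hp : p ∈ Icc s t) (v w : ℝ) (E : Set ℝ) :
    kvar K (bridge μ s t p v w) (E ∩ Icc s t) ≤
      (if p ∈ E then (K ‖v‖₊ : ℝ≥0∞) else 0) + (if t ∈ E then (K ‖w‖₊ : ℝ≥0∞) else 0) := by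
  set ν := bridge μ s t p v w with hν
  have hs : ∀ x ∈ Icc s t, ν {x} = (if p = x then v else 0) + (if t = x then w else 0) := by
    intro x hx
    have he : {x} ∩ (Icc s t)ᶜ = ∅ :=
      Set.eq_empty_of_forall_notMem fun y hy => hy.2 (hy.1 ▸ hx)
    rw [hν, bridge_apply _ _ _ _ _ _ (measurableSet_singleton x), he]
    simp
  have ht : t ∈ Icc s t := ⟨hp.1.trans hp.2, le_rfl⟩
  have hsub : E ∩ Icc s t ⊆ (E ∩ {p}) ∪ ((E ∩ {t}) \ {p}) ∪ (Icc s t \ {p, t}) := by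
    intro x hx
    by_cases h1 : x = p <;> by_cases h2 : x = t <;> simp_all
  have hrest : kvar K ν (Icc s t \ {p, t}) = 0 := by
    refine kvar_eq_zero hK.map_zero (measurableSet_Icc.diff (by simp)) fun T hT hTm => ?_
    have he : T ∩ (Icc s t)ᶜ = ∅ :=
      Set.eq_empty_of_forall_notMem fun y hy => hy.2 (hT hy.1).1
    rw [hν, bridge_apply _ _ _ _ _ _ hTm, if_neg, if_neg]
    · rw [he]
      simp
    · intro h; exact (hT h).2 (by simp)
    · intro h; exact (hT h).2 (by simp)
  have hmono : ∀ x c : ℝ, ∀ F : Set ℝ, F ⊆ E ∩ {x} →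
      (x ∈ F → (K ‖ν {x}‖₊ : ℝ≥0∞) ≤ K ‖c‖₊) →
      kvar K ν F ≤ if x ∈ E then (K ‖c‖₊ : ℝ≥0∞) else 0 := by
    intro x c F hF hx
    rcases subset_singleton_iff_eq.1 (hF.trans inter_subset_right) with h | h
    · simp [h]
    · have hxF : x ∈ F := h ▸ mem_singleton x
      rw [if_pos (hF hxF).1, h, kvar_singleton]
      exact hx hxF
  by_cases hpt : p = t
  · subst hpt
    have h1 : kvar K ν (E ∩ Icc s p) ≤ if p ∈ E then (K ‖v + w‖₊ : ℝ≥0∞) else 0 := by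
      refine (measure_mono hsub).trans ((measure_union_le _ _).trans ?_)
      rw [hrest, add_zero]
      have : (E ∩ {p}) ∪ ((E ∩ {p}) \ {p}) = E ∩ {p} :=
        union_eq_left.2 sdiff_subset
      rw [this]
      exact hmono p (v + w) _ subset_rfl fun _ => by rw [hs p hp]; simp
    refine h1.trans ?_
    split_ifs
    · exact_mod_cast hK.nnnorm_add_le v w
    · simp
  · refine (measure_mono hsub).trans ((measure_union_le _ _).trans ?_)
    rw [hrest, add_zero]
    refine (measure_union_le _ _).trans (add_le_add ?_ ?_)
    · exact hmono p v _ subset_rfl fun _ => by rw [hs p hp]; simp [Ne.symm hpt]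
    · exact hmono t w _ sdiff_subset fun _ => by rw [hs t ht]; simp [hpt]

/-! ### Excursions beyond a level -/

/-- The competitor equals `c` on `(s, t)`, with one mass at `s` to reach `c` and one at `t` to
rejoin `P`. The conditions on these jumps are required only at interior endpoints, since `a` and `b`
are not charged. The jump cost does not grow while the fidelity strictly falls. -/
lemma IsMinPrim.false_of_closer {K : ℝ≥0 → ℝ≥0} (hK : Admissible K) {lam a b : ℝ}
    (hlam : 0 < lam) {g : ℝ → ℝ} (hg : AEMeasurable g (volume.restrict (Ioo a b))) {k : ℝ}
    {μ : SignedMeasure ℝ} (hm : IsMinPrim K lam a b g k μ) {s t c : ℝ} (has : a ≤ s) (hst : s < t)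
    (htb : t ≤ b) (hs : a < s → |c - primLeft k μ s| ≤ |prim k μ s - primLeft k μ s|)
    (ht : t < b → |prim k μ t - c| ≤ |prim k μ t - primLeft k μ t|)
    (hlt : ∀ᵐ x ∂volume.restrict (Ioo s t), (c - g x) ^ 2 < (prim k μ x - g x) ^ 2) : False := by
  classical
  have hp : s ∈ Icc s t := ⟨le_rfl, hst.le⟩
  set v := c - primLeft k μ s with hv
  set w := prim k μ t - c with hw
  have hatom : ∀ x, prim k μ x - primLeft k μ x = μ {x} := fun x => by
    rw [← primLeft_add_singleton]; ring
  have hle := hm.local_le has hst htb (μ' := bridge μ s t s v w)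
    (fun T hT hTm => bridge_agree μ hp v w hT hTm) (by
      rw [bridge_Icc μ hp, hv, hw, ← primLeft_add_Icc k μ hst.le]; ring)
  have hkv : kvar K (bridge μ s t s v w) (Ioo a b ∩ Icc s t) ≤ kvar K μ (Ioo a b ∩ Icc s t) := by
    refine (kvar_bridge_le hK μ hp v w _).trans ?_
    have hsub : (Ioo a b ∩ {s}) ∪ (Ioo a b ∩ {t}) ⊆ Ioo a b ∩ Icc s t := by
      rintro x (⟨hx, rfl⟩ | ⟨hx, rfl⟩)
      exacts [⟨hx, le_rfl, hst.le⟩, ⟨hx, hst.le, le_rfl⟩]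
    refine le_trans ?_ (measure_mono hsub)
    rw [measure_union (by
      rw [Set.disjoint_left]
      rintro x ⟨-, rfl⟩ ⟨-, h⟩
      exact hst.ne h) (measurableSet_Ioo.inter (measurableSet_singleton t))]
    refine add_le_add ?_ ?_
    · split_ifs with h
      · rw [inter_eq_right.2 (singleton_subset_iff.2 h), kvar_singleton]
        refine ENNReal.coe_le_coe.2 (hK.mono ?_)
        rw [← NNReal.coe_le_coe, coe_nnnorm, coe_nnnorm, ← hatom]
        exact hs h.1
      · simp
    · split_ifs with h
      · rw [inter_eq_right.2 (singleton_subset_iff.2 h), kvar_singleton]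
        refine ENNReal.coe_le_coe.2 (hK.mono ?_)
        rw [← NNReal.coe_le_coe, coe_nnnorm, coe_nnnorm, ← hatom]
        exact ht h.2
      · simp
  obtain ⟨hf1, hf2⟩ := hm.local_lt_top has htb (s := s) (t := t)
  have hf1' : kvar K μ (Ioo a b ∩ Icc s t) ≠ ⊤ :=
    ((measure_mono inter_subset_left).trans_lt hf1).ne
  have hfid : fidelity lam s t g (prim k μ) ≤ fidelity lam s t g fun _ => c := by
    have h1 := (ENNReal.add_le_add_iff_left hf1').1 (hle.trans (add_le_add_left hkv _))
    refine h1.trans (le_of_eq (fidelity_congr lam s t g ?_))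
    filter_upwards [ae_restrict_mem measurableSet_Ioo] with x hx
    rw [prim_bridge k μ hp v w hx, if_pos hx.1.le, hv]; ring
  have hl0 : ENNReal.ofReal (lam / 2) ≠ 0 := by
    rw [Ne, ENNReal.ofReal_eq_zero, not_le]; positivity
  rw [fidelity, fidelity, ENNReal.mul_le_mul_iff_right hl0 ENNReal.ofReal_ne_top] at hfid
  rw [fidelity] at hf2
  have hPtop : ∫⁻ x in Ioo s t, ENNReal.ofReal ((prim k μ x - g x) ^ 2) ≠ ⊤ := fun h => by
    rw [h, ENNReal.mul_top hl0] at hf2; exact hf2.false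
  have hgm : AEMeasurable g (volume.restrict (Ioo s t)) :=
    hg.mono_set (Ioo_subset_Ioo has htb)
  have hlt' : ∀ᵐ x ∂volume.restrict (Ioo s t),
      ENNReal.ofReal ((c - g x) ^ 2) < ENNReal.ofReal ((prim k μ x - g x) ^ 2) := by
    filter_upwards [hlt] with x hx
    exact (ENNReal.ofReal_lt_ofReal_iff_of_nonneg (sq_nonneg _)).2 hx
  refine hfid.not_gt (lintegral_strict_mono ?_ ?_ ?_ hlt')
  · rw [Ne, Measure.restrict_eq_zero]
    simp [hst]
  · exact (((measurable_prim k μ).aemeasurable.sub hgm).pow_const 2).ennreal_ofReal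
  · exact ((lintegral_mono_ae (hlt'.mono fun x hx => hx.le)).trans_lt hPtop.lt_top).ne

/-- The maximal interval around `x₀` on which `P` exceeds the level `c`. -/
lemma exists_excursion {a b c x₀ : ℝ} {P Q : ℝ → ℝ}
    (hr : ∀ x, Tendsto P (𝓝[>] x) (𝓝 (P x))) (hl : ∀ x, Tendsto P (𝓝[<] x) (𝓝 (Q x)))
    (hx : x₀ ∈ Ioo a b) (h : c < P x₀) :
    ∃ s t, a ≤ s ∧ s ≤ x₀ ∧ x₀ < t ∧ t ≤ b ∧ (∀ x ∈ Ioo s t, c < P x) ∧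
      (a < s → |c - Q s| ≤ |P s - Q s|) ∧ (t < b → |P t - c| ≤ |P t - Q t|) ∧
      (∀ y ∈ Icc x₀ b, P y ≤ c → t ≤ y) ∧ (∀ y ∈ Icc a x₀, P y ≤ c → y ≤ s) := by
  have hright : ∀ x, c < P x → ∃ d, x < d ∧ ∀ y ∈ Ioo x d, c < P y := fun x hx =>
    mem_nhdsGT_iff_exists_Ioo_subset.1 ((hr x).eventually (lt_mem_nhds hx))
  -- Admitting `b` by default makes `S` nonempty when the excursion runs up to the boundary; `a`
  -- plays the same role in `T`.
  set S := {y | y ∈ Icc x₀ b ∧ (P y ≤ c ∨ y = b)} with hS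
  set T := {y | y ∈ Icc a x₀ ∧ (P y ≤ c ∨ y = a)} with hT
  have hbS : b ∈ S := ⟨⟨hx.2.le, le_rfl⟩, Or.inr rfl⟩
  have haT : a ∈ T := ⟨⟨le_rfl, hx.1.le⟩, Or.inr rfl⟩
  have hSb : BddBelow S := ⟨x₀, fun y hy => hy.1.1⟩
  have hTb : BddAbove T := ⟨x₀, fun y hy => hy.1.2⟩
  have hxt : x₀ < sInf S := by
    obtain ⟨d, hd, hd'⟩ := hright x₀ h
    refine (lt_min hd hx.2).trans_le (le_csInf ⟨b, hbS⟩ fun y hy => ?_)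
    by_contra! hy'
    rcases hy.2 with h1 | h1
    · rcases hy.1.1.eq_or_lt with h2 | h2
      · exact h.not_ge (h2 ▸ h1)
      · exact (hd' y ⟨h2, hy'.trans_le (min_le_left _ _)⟩).not_ge h1
    · exact (hy'.trans_le (min_le_right _ _)).ne h1
  have hsx : sSup T ≤ x₀ := csSup_le ⟨a, haT⟩ fun y hy => hy.1.2
  have hbet : ∀ x ∈ Ioo (sSup T) (sInf S), c < P x := by
    intro x hxx
    by_contra! hc
    rcases le_total x x₀ with h1 | h1
    · refine hxx.1.not_ge ?_
      rcases le_total a x with h2 | h2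
      · exact le_csSup hTb ⟨⟨h2, h1⟩, Or.inl hc⟩
      · exact h2.trans (le_csSup hTb haT)
    · refine hxx.2.not_ge ?_
      rcases le_total x b with h2 | h2
      · exact csInf_le hSb ⟨⟨h1, h2⟩, Or.inl hc⟩
      · exact (csInf_le hSb hbS).trans h2
  refine ⟨sSup T, sInf S, le_csSup hTb haT, hsx, hxt, csInf_le hSb hbS, hbet, ?_, ?_,
    fun y hy hc => csInf_le hSb ⟨hy, Or.inl hc⟩, fun y hy hc => le_csSup hTb ⟨hy, Or.inl hc⟩⟩
  · intro has
    set s := sSup T with hs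
    -- Either `P s = c` by right-continuity, and the jump is unchanged, or `P s > c`; then points
    -- with `P ≤ c` accumulate at `s` from the left, so `Q s ≤ c < P s` and the jump is shortened.
    rcases le_or_gt (P s) c with hP | hP
    · have hc : c ≤ P s := by
        refine ge_of_tendsto (hr s) ?_
        filter_upwards [Ioo_mem_nhdsGT (hsx.trans_lt hxt)] with y hy
        exact (hbet y hy).le
      rw [le_antisymm hc hP]
    · have hQ : Q s ≤ c := by
        by_contra! hQ
        obtain ⟨d, hd, hd'⟩ := mem_nhdsLT_iff_exists_Ioo_subset.1
          ((hl s).eventually (lt_mem_nhds hQ))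
        have hd : d < s := hd
        obtain ⟨y, hy, hdy⟩ := exists_lt_of_lt_csSup ⟨a, haT⟩ (max_lt hd has)
        have hys : y ≤ s := le_csSup hTb hy
        have hya : a < y := (le_max_right _ _).trans_lt hdy
        have hyc : P y ≤ c := hy.2.resolve_right hya.ne'
        rcases hys.eq_or_lt with h1 | h1
        · exact hP.not_ge (h1 ▸ hyc)
        · exact (hd' ⟨(le_max_left _ _).trans_lt hdy, h1⟩ : c < P y).not_ge hyc
      rw [abs_of_nonneg (by linarith), abs_of_nonneg (by linarith)]
      linarith
  · intro htb
    set t := sInf S with ht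
    have hP : P t ≤ c := by
      by_contra! hP
      obtain ⟨d, hd, hd'⟩ := hright t hP
      obtain ⟨y, hy, hyd⟩ := exists_lt_of_csInf_lt ⟨b, hbS⟩ (lt_min hd htb)
      have hty : t ≤ y := csInf_le hSb hy
      have hyc : P y ≤ c := hy.2.resolve_right (hyd.trans_le (min_le_right _ _)).ne
      rcases hty.eq_or_lt with h1 | h1
      · exact hP.not_ge (h1 ▸ hyc)
      · exact (hd' y ⟨h1, hyd.trans_le (min_le_left _ _)⟩).not_ge hyc
    have hQ : c ≤ Q t := by
      refine ge_of_tendsto (hl t) ?_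
      filter_upwards [Ioo_mem_nhdsLT (hsx.trans_lt hxt)] with y hy
      exact (hbet y hy).le
    rw [abs_sub_comm, abs_sub_comm (P t), abs_of_nonneg (by linarith), abs_of_nonneg (by linarith)]
    linarith

section Excursions

variable {K : ℝ≥0 → ℝ≥0} {lam a b : ℝ} {g : ℝ → ℝ} {k : ℝ} {μ : SignedMeasure ℝ}

lemma IsMinPrim.exists_excursion_above (hm : IsMinPrim K lam a b g k μ) (hK : Admissible K)
    (hlam : 0 < lam) (hg : AEMeasurable g (volume.restrict (Ioo a b))) {c x₀ : ℝ}
    (hx : x₀ ∈ Ioo a b) (h : c < prim k μ x₀) :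
    ∃ s t, a ≤ s ∧ s ≤ x₀ ∧ x₀ < t ∧ t ≤ b ∧ (∀ x ∈ Ioo s t, c < prim k μ x) ∧
      (∀ y ∈ Icc x₀ b, prim k μ y ≤ c → t ≤ y) ∧ (∀ y ∈ Icc a x₀, prim k μ y ≤ c → y ≤ s) ∧
      ¬ ∀ᵐ x ∂volume.restrict (Ioo s t), g x ≤ c := by
  obtain ⟨s, t, has, hsx, hxt, htb, hP, hs, ht, h1, h2⟩ :=
    exists_excursion (tendsto_prim_right k μ) (tendsto_prim_left k μ) hx h
  refine ⟨s, t, has, hsx, hxt, htb, hP, h1, h2, fun hae => ?_⟩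
  refine hm.false_of_closer hK hlam hg has (hsx.trans_lt hxt) htb hs ht ?_
  filter_upwards [hae, ae_restrict_mem measurableSet_Ioo] with x hx hx'
  have := hP x hx'
  nlinarith

lemma IsMinPrim.exists_excursion_below (hm : IsMinPrim K lam a b g k μ) (hK : Admissible K)
    (hlam : 0 < lam) (hg : AEMeasurable g (volume.restrict (Ioo a b))) {c x₀ : ℝ}
    (hx : x₀ ∈ Ioo a b) (h : prim k μ x₀ < c) :
    ∃ s t, a ≤ s ∧ s ≤ x₀ ∧ x₀ < t ∧ t ≤ b ∧ (∀ x ∈ Ioo s t, prim k μ x < c) ∧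
      (∀ y ∈ Icc x₀ b, c ≤ prim k μ y → t ≤ y) ∧ (∀ y ∈ Icc a x₀, c ≤ prim k μ y → y ≤ s) ∧
      ¬ ∀ᵐ x ∂volume.restrict (Ioo s t), c ≤ g x := by
  obtain ⟨s, t, has, hsx, hxt, htb, hP, hs, ht, h1, h2⟩ :=
    exists_excursion (P := fun x => -prim k μ x) (Q := fun x => -primLeft k μ x) (c := -c)
      (fun x => (tendsto_prim_right k μ x).neg) (fun x => (tendsto_prim_left k μ x).neg) hx
      (neg_lt_neg h)
  refine ⟨s, t, has, hsx, hxt, htb, fun x hx => neg_lt_neg_iff.1 (hP x hx),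
    fun y hy hc => h1 y hy (neg_le_neg hc), fun y hy hc => h2 y hy (neg_le_neg hc), fun hae => ?_⟩
  refine hm.false_of_closer hK hlam hg has (hsx.trans_lt hxt) htb (c := c) (fun h => ?_)
    (fun h => ?_) ?_
  · have := hs h
    rwa [neg_sub_neg, neg_sub_neg, abs_sub_comm, abs_sub_comm (primLeft k μ s)] at this
  · have := ht h
    rwa [neg_sub_neg, neg_sub_neg, abs_sub_comm, abs_sub_comm (primLeft k μ t)] at this
  · filter_upwards [hae, ae_restrict_mem measurableSet_Ioo] with x hx hx'
    have := hP x hx'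
    nlinarith

lemma IsMinPrim.prim_le (hm : IsMinPrim K lam a b g k μ) (hK : Admissible K)
    (hlam : 0 < lam) (hg : AEMeasurable g (volume.restrict (Ioo a b))) {c : ℝ}
    (hc : ∀ᵐ x ∂volume.restrict (Ioo a b), g x ≤ c) {x : ℝ} (hx : x ∈ Ioo a b) :
    prim k μ x ≤ c := by
  by_contra! h
  obtain ⟨s, t, has, -, -, htb, -, -, -, hn⟩ := hm.exists_excursion_above hK hlam hg hx h
  exact hn (ae_restrict_of_ae_restrict_of_subset (Ioo_subset_Ioo has htb) hc)

lemma IsMinPrim.le_prim (hm : IsMinPrim K lam a b g k μ) (hK : Admissible K)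
    (hlam : 0 < lam) (hg : AEMeasurable g (volume.restrict (Ioo a b))) {c : ℝ}
    (hc : ∀ᵐ x ∂volume.restrict (Ioo a b), c ≤ g x) {x : ℝ} (hx : x ∈ Ioo a b) :
    c ≤ prim k μ x := by
  by_contra! h
  obtain ⟨s, t, has, -, -, htb, -, -, -, hn⟩ := hm.exists_excursion_below hK hlam hg hx h
  exact hn (ae_restrict_of_ae_restrict_of_subset (Ioo_subset_Ioo has htb) hc)

/-- If `P` decreased from `x` to `y`, then for a level `c` in between there would be an excursion
above `c` around `x` and, to its right, one below `c` around `y`. The first forces `g > c` somewhere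
on it, and then monotonicity of `g` gives `g ≥ c` throughout the second, which is impossible. -/
lemma IsMinPrim.monotoneOn (hm : IsMinPrim K lam a b g k μ) (hK : Admissible K)
    (hlam : 0 < lam) (hg : AEMeasurable g (volume.restrict (Ioo a b)))
    (hmono : AENondecreasing a b g) : MonotoneOn (prim k μ) (Ioo a b) := by
  obtain ⟨h, hh, hgh⟩ := hmono
  intro x hx y hy hxy
  by_contra! hlt
  set c := (prim k μ x + prim k μ y) / 2 with hc
  obtain ⟨s, t, has, hsx, hxt, htb, hP, h1, -, hn⟩ :=
    hm.exists_excursion_above hK hlam hg hx (c := c) (by linarith)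
  obtain ⟨s', t', has', hsy', hyt', htb', hP', -, h2, hn'⟩ :=
    hm.exists_excursion_below hK hlam hg hy (c := c) (by linarith)
  have hty : t ≤ y := h1 y ⟨hxy, hy.2.le⟩ (by linarith)
  have hae := ae_restrict_of_ae_restrict_of_subset (Ioo_subset_Ioo has htb) hgh
  have hae' := ae_restrict_of_ae_restrict_of_subset (Ioo_subset_Ioo has' htb') hgh
  by_cases hz : ∀ z ∈ Ioo s t, h z ≤ c
  · refine hn ?_
    filter_upwards [hae, ae_restrict_mem measurableSet_Ioo] with z hz1 hz2
    rw [hz1]; exact hz z hz2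
  · push Not at hz
    obtain ⟨z, hz, hzc⟩ := hz
    have hmax : max x z < t := max_lt hxt hz.2
    -- The point `q` lies in the first excursion beyond `z`, so the second one starts after `q` and
    -- hence after `z`.
    obtain ⟨q, hq1, hq2⟩ := exists_between hmax
    have hqx := (le_max_left _ _).trans_lt hq1
    have hqz := (le_max_right _ _).trans_lt hq1
    have hqs : q ≤ s' := h2 q ⟨(hx.1.trans hqx).le, hq2.le.trans hty⟩
      (hP q ⟨hsx.trans_lt hqx, hq2⟩).le
    refine hn' ?_
    filter_upwards [hae', ae_restrict_mem measurableSet_Ioo] with w hw1 hw2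
    rw [hw1]
    exact hzc.le.trans (hh ⟨has.trans_lt hz.1, hz.2.trans_le htb⟩
      ⟨has'.trans_lt hw2.1, hw2.2.trans_le htb'⟩ (hqz.le.trans (hqs.trans hw2.1.le)))

end Excursions

/-! ### Monotone minimizers are piecewise constant -/

/-- Provides the location of the competitor's single jump; `τ` may be an endpoint, so `s` is
admitted to `T` by default. -/
lemma exists_crossing {h : ℝ → ℝ} {s t : ℝ} (hst : s ≤ t) (hh : MonotoneOn h (Icc s t)) (c : ℝ) :
    ∃ τ ∈ Icc s t, (∀ x ∈ Ioo s τ, h x ≤ c) ∧ ∀ x ∈ Ioo τ t, c ≤ h x := by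
  set T := {x | x ∈ Icc s t ∧ (x = s ∨ h x ≤ c)} with hT
  have hsT : s ∈ T := ⟨⟨le_rfl, hst⟩, Or.inl rfl⟩
  have hTb : BddAbove T := ⟨t, fun x hx => hx.1.2⟩
  have hsτ : s ≤ sSup T := le_csSup hTb hsT
  have hτt : sSup T ≤ t := csSup_le ⟨s, hsT⟩ fun x hx => hx.1.2
  refine ⟨sSup T, ⟨hsτ, hτt⟩, fun x hx => ?_, fun x hx => ?_⟩
  · obtain ⟨y, hy, hxy⟩ := exists_lt_of_lt_csSup ⟨s, hsT⟩ hx.2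
    have hyc := hy.2.resolve_left (hx.1.trans hxy).ne'
    exact (hh ⟨hx.1.le, hx.2.le.trans hτt⟩ hy.1 hxy.le).trans hyc
  · by_contra! hc
    exact hx.1.not_ge (le_csSup hTb ⟨⟨hsτ.trans hx.1.le, hx.2.le⟩, Or.inr hc.le⟩)

section Monotone

variable {K : ℝ≥0 → ℝ≥0} {lam a b : ℝ} {g : ℝ → ℝ} {k : ℝ} {μ : SignedMeasure ℝ}

lemma primLeft_mem (hP : MonotoneOn (prim k μ) (Ioo a b)) {s : ℝ} (hs : s ∈ Ioo a b) :
    primLeft k μ s ≤ prim k μ s ∧ ∀ y ∈ Ioo a s, prim k μ y ≤ primLeft k μ s := by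
  constructor
  · refine le_of_tendsto (tendsto_prim_left k μ s) ?_
    filter_upwards [Ioo_mem_nhdsLT hs.1] with y hy
    exact hP ⟨hy.1, hy.2.trans hs.2⟩ hs hy.2.le
  · intro y hy
    refine ge_of_tendsto (tendsto_prim_left k μ s) ?_
    filter_upwards [Ioo_mem_nhdsLT hy.2] with z hz
    exact hP ⟨hy.1, hy.2.trans hs.2⟩ ⟨hy.1.trans hz.1, hz.2.trans hs.2⟩ hz.1.le

/-- The gain in the jump part from merging is bounded by the loss in fidelity. -/
lemma IsMinPrim.mul_le (hm : IsMinPrim K lam a b g k μ) (hK : Admissible K) (hlam : 0 < lam)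
    (hmono : AENondecreasing a b g) (hP : MonotoneOn (prim k μ) (Ioo a b))
    {M C : ℝ} (hKC : SubaddWith K M C) {s t : ℝ} (has : a < s) (hst : s < t) (htb : t < b)
    (hosc : prim k μ t - primLeft k μ s ≤ M) {S : ℝ}
    (hS : ∀ x ∈ Icc s t, (prim k μ x - primLeft k μ s) * (prim k μ t - prim k μ x) ≤ S)
    {z : ℝ} (hz : z ∈ Icc s t) :
    C * ((prim k μ z - primLeft k μ s) * (prim k μ t - prim k μ z)) ≤ lam / 2 * (t - s) * S := by
  classical
  obtain ⟨h, hh, hgh⟩ := hmono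
  set α := primLeft k μ s with hα
  set β := prim k μ t with hβ
  have hI : Icc s t ⊆ Ioo a b := Icc_subset_Ioo has htb
  have hαP : ∀ x ∈ Icc s t, α ≤ prim k μ x := fun x hx =>
    (primLeft_mem hP (hI ⟨le_rfl, hst.le⟩)).1.trans (hP (hI ⟨le_rfl, hst.le⟩) (hI hx) hx.1)
  have hPβ : ∀ x ∈ Icc s t, prim k μ x ≤ β := fun x hx => hP (hI hx) (hI ⟨hst.le, le_rfl⟩) hx.2
  have hS0 : 0 ≤ S :=
    (mul_nonneg (sub_nonneg.2 (hαP z hz)) (sub_nonneg.2 (hPβ z hz))).trans (hS z hz)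
  -- At the midpoint the datum is equally far from `α` and `β`, so the competitor takes the closer
  -- of the two on each side of `τ`.
  obtain ⟨τ, hτ, hτ1, hτ2⟩ := exists_crossing hst.le (hh.mono hI) ((α + β) / 2)
  have hle := hm.local_le has.le hst htb.le (μ' := bridge μ s t τ (β - α) 0)
    (fun T hT hTm => bridge_agree μ hτ _ _ hT hTm) (by
      rw [bridge_Icc μ hτ, hα, hβ, ← primLeft_add_Icc k μ hst.le]; ring)
  have hkv := kvar_bridge_le hK μ hτ (β - α) 0 (Ioo a b)
  rw [if_pos (hI hτ), if_pos (hI ⟨hst.le, le_rfl⟩), nnnorm_zero, hK.map_zero, ENNReal.coe_zero,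
    add_zero] at hkv
  have hfid : fidelity lam s t g (prim k (bridge μ s t τ (β - α) 0)) ≤
      fidelity lam s t g (prim k μ) + ENNReal.ofReal (lam / 2 * (t - s) * S) := by
    have h1 : ENNReal.ofReal (lam / 2 * (t - s) * S) =
        ENNReal.ofReal (lam / 2) * ∫⁻ _ in Ioo s t, ENNReal.ofReal S := by
      rw [setLIntegral_const, Real.volume_Ioo, ← ENNReal.ofReal_mul hS0,
        ← ENNReal.ofReal_mul (by positivity)]
      congr 1; ring
    rw [fidelity, fidelity, h1, ← mul_add, ← lintegral_add_right _ measurable_const]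
    gcongr ENNReal.ofReal (lam / 2) * ?_
    refine lintegral_mono_ae ?_
    have hne : ∀ᵐ x ∂volume.restrict (Ioo s t), x ≠ τ :=
      ae_restrict_of_ae (compl_mem_ae_iff.2 (measure_singleton τ))
    filter_upwards [ae_restrict_of_ae_restrict_of_subset (Ioo_subset_Ioo has.le htb.le) hgh,
      ae_restrict_mem measurableSet_Ioo, hne] with x hx hx' hxτ
    rw [← ENNReal.ofReal_add (sq_nonneg _) hS0]
    refine ENNReal.ofReal_le_ofReal ?_
    rw [prim_bridge k μ hτ _ _ hx', ← hα, hx]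
    have h1 := hαP x (Ioo_subset_Icc_self hx')
    have h2 := hPβ x (Ioo_subset_Icc_self hx')
    have h3 := hS x (Ioo_subset_Icc_self hx')
    -- To the left of `τ`, `(α - h)² - (P - h)² = (P - α) * (2 * h - α - P) ≤ (P - α) * (β - P)`,
    -- because `2 * h ≤ α + β`. The right side is symmetric.
    rcases lt_or_gt_of_ne hxτ with hlt | hgt
    · rw [if_neg hlt.not_ge, add_zero]
      have h4 := hτ1 x ⟨hx'.1, hlt⟩
      nlinarith
    · rw [if_pos hgt.le]
      have h4 := hτ2 x ⟨hgt, hx'.2⟩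
      nlinarith
  have hF := (hm.local_lt_top has.le htb.le (s := s) (t := t)).2.ne
  have h1 : kvar K μ (Icc s t) ≤ K ‖β - α‖₊ + ENNReal.ofReal (lam / 2 * (t - s) * S) := by
    rw [inter_eq_right.2 hI] at hle hkv
    refine (ENNReal.add_le_add_iff_right hF).1 (hle.trans ((add_le_add hkv hfid).trans ?_))
    rw [add_assoc, add_comm (fidelity _ _ _ _ _)]
  -- Splitting at `z`, each of `[s, z]` and `(z, t]` costs at least one jump carrying its whole
  -- increment.
  have h2 : (K ‖prim k μ z - α‖₊ : ℝ≥0∞) + K ‖β - prim k μ z‖₊ ≤ kvar K μ (Icc s t) := by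
    rw [← Icc_union_Ioc_eq_Icc hz.1 hz.2, measure_union (by
      rw [Set.disjoint_left]; intro y hy hy'; exact hy'.1.not_ge hy.2) measurableSet_Ioc,
      hα, hβ, ← primLeft_add_Icc k μ hz.1, ← prim_add_Ioc k μ hz.2, primLeft_add_Icc k μ hz.1,
      add_sub_cancel_left, ← primLeft_add_Icc k μ hz.1, add_sub_cancel_left]
    exact add_le_add (hK.le_kvar μ measurableSet_Icc) (hK.le_kvar μ measurableSet_Ioc)
  have hr0 : 0 ≤ prim k μ z - α := sub_nonneg.2 (hαP z hz)
  have hq0 : 0 ≤ β - prim k μ z := sub_nonneg.2 (hPβ z hz)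
  set r := ‖prim k μ z - α‖₊ with hr
  set q := ‖β - prim k μ z‖₊ with hq
  have hrv : (r : ℝ) = prim k μ z - α := by rw [hr, coe_nnnorm, Real.norm_of_nonneg hr0]
  have hqv : (q : ℝ) = β - prim k μ z := by rw [hq, coe_nnnorm, Real.norm_of_nonneg hq0]
  have hrq : ‖β - α‖₊ = r + q := by
    rw [← NNReal.coe_inj, NNReal.coe_add, hrv, hqv, coe_nnnorm,
      Real.norm_of_nonneg (by linarith)]; ring
  have hX : 0 ≤ lam / 2 * (t - s) * S :=
    mul_nonneg (mul_nonneg (by positivity) (sub_nonneg.2 hst.le)) hS0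
  have h3 := h2.trans h1
  rw [hrq, ← ENNReal.coe_add, ← ENNReal.ofReal_coe_nnreal, ← ENNReal.ofReal_coe_nnreal (p := K _),
    ← ENNReal.ofReal_add NNReal.zero_le_coe hX,
    ENNReal.ofReal_le_ofReal_iff (add_nonneg NNReal.zero_le_coe hX), NNReal.coe_add] at h3
  have h4 := hKC r q (by rw [hrv, hqv]; linarith)
  rw [hrv, hqv] at h4
  linarith

/-- On short intervals a monotone minimizer takes at most two values. -/
lemma IsMinPrim.eq_or_eq (hm : IsMinPrim K lam a b g k μ) (hK : Admissible K) (hlam : 0 < lam)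
    (hmono : AENondecreasing a b g) (hP : MonotoneOn (prim k μ) (Ioo a b))
    {M C : ℝ} (hKC : SubaddWith K M C) {s t : ℝ} (has : a < s) (hst : s < t) (htb : t < b)
    (hosc : prim k μ t - primLeft k μ s ≤ M) (hshort : lam / 2 * (t - s) < C)
    {z : ℝ} (hz : z ∈ Icc s t) :
    prim k μ z = primLeft k μ s ∨ prim k μ z = prim k μ t := by
  set α := primLeft k μ s with hα
  set β := prim k μ t with hβ
  have hI : Icc s t ⊆ Ioo a b := Icc_subset_Ioo has htb
  have hαP : ∀ x ∈ Icc s t, α ≤ prim k μ x := fun x hx =>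
    (primLeft_mem hP (hI ⟨le_rfl, hst.le⟩)).1.trans (hP (hI ⟨le_rfl, hst.le⟩) (hI hx) hx.1)
  have hPβ : ∀ x ∈ Icc s t, prim k μ x ≤ β := fun x hx => hP (hI hx) (hI ⟨hst.le, le_rfl⟩) hx.2
  set f : ℝ → ℝ := fun x => (prim k μ x - α) * (β - prim k μ x) with hf
  have hf0 : ∀ x ∈ Icc s t, 0 ≤ f x := fun x hx =>
    mul_nonneg (sub_nonneg.2 (hαP x hx)) (sub_nonneg.2 (hPβ x hx))
  have hbdd : BddAbove (f '' Icc s t) := by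
    refine ⟨(β - α) ^ 2, ?_⟩
    rintro _ ⟨x, hx, rfl⟩
    have h1 := hαP x hx
    have h2 := hPβ x hx
    simp only [hf]
    nlinarith
  set S := sSup (f '' Icc s t) with hS
  have hfS : ∀ x ∈ Icc s t, f x ≤ S := fun x hx => le_csSup hbdd ⟨x, hx, rfl⟩
  have hCpos : 0 < C := lt_of_le_of_lt (mul_nonneg (by positivity) (sub_nonneg.2 hst.le)) hshort
  have hS0 : 0 ≤ S := (hf0 z hz).trans (hfS z hz)
  -- The bound `mul_le` holds at every point with the same `S`, so it passes to the supremum; the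
  -- factor `lam / 2 * (t - s) / C < 1` then forces `S = 0`.
  have hle : S ≤ lam / 2 * (t - s) * S / C := by
    refine csSup_le ⟨_, z, hz, rfl⟩ ?_
    rintro _ ⟨x, hx, rfl⟩
    rw [le_div_iff₀ hCpos, mul_comm]
    exact hm.mul_le hK hlam hmono hP hKC has hst htb hosc hfS hx
  rw [le_div_iff₀ hCpos] at hle
  have hS' : S = 0 := by nlinarith
  have hfz : f z = 0 := le_antisymm (hS' ▸ hfS z hz) (hf0 z hz)
  rcases mul_eq_zero.1 hfz with h | h
  · left; linarith
  · right; linarith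

/-- Jumps of a monotone minimizer are at least `2 C / lam` apart. -/
lemma IsMinPrim.jump_separation (hm : IsMinPrim K lam a b g k μ) (hK : Admissible K)
    (hlam : 0 < lam) (hmono : AENondecreasing a b g) (hP : MonotoneOn (prim k μ) (Ioo a b))
    {M C : ℝ} (hKC : SubaddWith K M C) {s t : ℝ} (has : a < s) (hst : s < t) (htb : t < b)
    (hosc : prim k μ t - primLeft k μ s ≤ M) (hs : μ {s} ≠ 0) (ht : μ {t} ≠ 0) :
    C ≤ lam / 2 * (t - s) := by
  by_contra! hshort
  have h1 := primLeft_add_singleton k μ s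
  have h2 := primLeft_add_singleton k μ t
  rcases hm.eq_or_eq hK hlam hmono hP hKC has hst htb hosc hshort ⟨le_rfl, hst.le⟩ with h | h
  · exact hs (by linarith)
  · have h3 := primLeft_mem hP ⟨has.trans hst, htb⟩
    have h4 := h3.2 s ⟨has, hst⟩
    exact ht (by linarith [h3.1])

lemma continuousAt_prim {x : ℝ} (hx : μ {x} = 0) : ContinuousAt (prim k μ) x := by
  rw [continuousAt_iff_continuous_left'_right']
  refine ⟨?_, tendsto_prim_right k μ x⟩
  have := primLeft_add_singleton k μ x
  rw [hx, add_zero] at this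
  rw [ContinuousWithinAt, ← this]
  exact tendsto_prim_left k μ x

/-- Off its jumps a monotone minimizer is constant on short intervals. -/
lemma IsMinPrim.eq_of_short (hm : IsMinPrim K lam a b g k μ) (hK : Admissible K) (hlam : 0 < lam)
    (hmono : AENondecreasing a b g) (hP : MonotoneOn (prim k μ) (Ioo a b))
    {M C : ℝ} (hKC : SubaddWith K M C) {s t : ℝ} (has : a < s) (hst : s < t) (htb : t < b)
    (hosc : prim k μ t - primLeft k μ s ≤ M) (hshort : lam / 2 * (t - s) < C)
    (hno : ∀ x ∈ Icc s t, μ {x} = 0) : prim k μ s = prim k μ t := by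
  have hI : Icc s t ⊆ Ioo a b := Icc_subset_Ioo has htb
  have hcont : ContinuousOn (prim k μ) (Icc s t) := fun x hx =>
    (continuousAt_prim (hno x hx)).continuousWithinAt
  have hle : prim k μ s ≤ prim k μ t := hP (hI ⟨le_rfl, hst.le⟩) (hI ⟨hst.le, le_rfl⟩) hst.le
  have h1 := primLeft_add_singleton k μ s
  rw [hno s ⟨le_rfl, hst.le⟩, add_zero] at h1
  -- By continuity the midpoint of the two end values is attained; it would be a third value unless
  -- they coincide.
  obtain ⟨z, hz, hzv⟩ := intermediate_value_Icc hst.le hcont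
    (show (prim k μ s + prim k μ t) / 2 ∈ Icc (prim k μ s) (prim k μ t) from
      ⟨by linarith, by linarith⟩)
  rcases hm.eq_or_eq hK hlam hmono hP hKC has hst htb hosc hshort hz with h | h <;> linarith

end Monotone

/-! ### Counting the jumps and the structure of minimizing primitives -/

/-- On `J` the index `⌊(x - a) / L⌋₊` of the cell of length `L` containing `x` is strictly
increasing. Indices start at zero, which accounts for the `+ 1`. -/
lemma finite_of_separated {a b L : ℝ} (hL : 0 < L) {J : Set ℝ} (hJ : J ⊆ Ioo a b)
    (h : ∀ x ∈ J, ∀ y ∈ J, x < y → L ≤ y - x) :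
    J.Finite ∧ J.ncard ≤ ⌊(b - a) / L⌋₊ + 1 := by
  have hlt : ∀ x ∈ J, ∀ y ∈ J, x < y → ⌊(x - a) / L⌋₊ < ⌊(y - a) / L⌋₊ := by
    intro x hx y hy hxy
    have h0 : 0 ≤ (x - a) / L := div_nonneg (sub_nonneg.2 (hJ hx).1.le) hL.le
    rw [Nat.lt_iff_add_one_le, ← Nat.floor_add_one h0]
    refine Nat.floor_mono ?_
    have := h x hx y hy hxy
    rw [div_add_one hL.ne']
    gcongr
    linarith
  have hinj : InjOn (fun x => ⌊(x - a) / L⌋₊) J := by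
    intro x hx y hy hxy
    by_contra hne
    rcases lt_or_gt_of_ne hne with h' | h'
    · exact (hlt x hx y hy h').ne hxy
    · exact (hlt y hy x hx h').ne' hxy
  have hmaps : MapsTo (fun x => ⌊(x - a) / L⌋₊) J (Finset.range (⌊(b - a) / L⌋₊ + 1)) := by
    intro x hx
    simp only [Finset.coe_range, mem_Iio, Nat.lt_add_one_iff]
    refine Nat.floor_mono ?_
    have := (hJ hx).2
    gcongr
  refine ⟨Finite.of_injOn hmaps hinj (Finset.finite_toSet _), ?_⟩
  have := ncard_le_ncard_of_injOn _ hmaps hinj (Finset.finite_toSet _)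
  rwa [ncard_coe_finset, Finset.card_range] at this

lemma kvar_neg (K : ℝ≥0 → ℝ≥0) (μ : SignedMeasure ℝ) : kvar K (-μ) = kvar K μ := by
  simp [kvar]

section Structure

variable {K : ℝ≥0 → ℝ≥0} {lam a b : ℝ} {g : ℝ → ℝ} {k : ℝ} {μ : SignedMeasure ℝ}

lemma prim_neg (k : ℝ) (μ : SignedMeasure ℝ) (x : ℝ) : prim (-k) (-μ) x = -prim k μ x := by
  simp [prim]; ring

lemma IsMinPrim.neg (hm : IsMinPrim K lam a b g k μ) :
    IsMinPrim K lam a b (fun x => -g x) (-k) (-μ) := by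
  have hf : ∀ k μ, fidelity lam a b (fun x => -g x) (prim (-k) (-μ)) =
      fidelity lam a b g (prim k μ) := fun k μ => by
    rw [fidelity, fidelity]
    congr 1
    refine lintegral_congr fun x => ?_
    rw [prim_neg]
    congr 1; ring
  refine ⟨?_, fun k' μ' => ?_⟩
  · rw [kvar_neg, hf]; exact hm.lt_top
  · have := hm.le (-k') (-μ')
    rwa [← hf (-k'), neg_neg, neg_neg, kvar_neg, ← kvar_neg K μ, ← hf k] at this

/-- The structure of minimizing primitives for non-decreasing data. -/
theorem IsMinPrim.structure_of_nondecreasing (hm : IsMinPrim K lam a b g k μ) (hK : Admissible K)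
    (hab : a < b) (hlam : 0 < lam) (hg : AEMeasurable g (volume.restrict (Ioo a b)))
    (hμb : μ {b} = 0) {M C m₀ m₁ : ℝ} (hC : 0 < C) (hKC : SubaddWith K M C)
    (h₀ : ∀ᵐ x ∂volume.restrict (Ioo a b), m₀ ≤ g x)
    (h₁ : ∀ᵐ x ∂volume.restrict (Ioo a b), g x ≤ m₁) (hosc : m₁ - m₀ ≤ M)
    (hmono : AENondecreasing a b g) :
    MonotoneOn (prim k μ) (Icc a b) ∧
      PiecewiseConst a b (Ioo a b ∩ {x | μ {x} ≠ 0}) (prim k μ) ∧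
      (∀ x ∈ Icc a b, m₀ ≤ prim k μ x ∧ prim k μ x ≤ m₁) ∧
      (Ioo a b ∩ {x | μ {x} ≠ 0}).ncard ≤ ⌊(b - a) * lam / (2 * C)⌋₊ + 1 := by
  have hP := hm.monotoneOn hK hlam hg hmono
  have hlo : ∀ x ∈ Ioo a b, m₀ ≤ prim k μ x := fun x hx => hm.le_prim hK hlam hg h₀ hx
  have hhi : ∀ x ∈ Ioo a b, prim k μ x ≤ m₁ := fun x hx => hm.prim_le hK hlam hg h₁ hx
  have hmM : ∀ s t, a < s → s < t → t < b → prim k μ t - primLeft k μ s ≤ M := by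
    intro s t has hst htb
    -- The left limit at `s` is bounded below through a point `w` of `(a, s)`, where `m₀ ≤ P`.
    obtain ⟨w, hw⟩ := exists_between has
    have h1 := (primLeft_mem hP ⟨has, hst.trans htb⟩).2 w hw
    have h2 := hlo w ⟨hw.1, hw.2.trans (hst.trans htb)⟩
    have h3 := hhi t ⟨has.trans hst, htb⟩
    linarith
  have hb : Tendsto (prim k μ) (𝓝[<] b) (𝓝 (prim k μ b)) := by
    rw [← primLeft_add_singleton, hμb, add_zero]
    exact tendsto_prim_left k μ b
  have hbounds : ∀ x ∈ Icc a b, m₀ ≤ prim k μ x ∧ prim k μ x ≤ m₁ := by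
    intro x hx
    rcases hx.2.eq_or_lt with rfl | hxb
    · constructor
      · refine ge_of_tendsto hb ?_
        filter_upwards [Ioo_mem_nhdsLT hab] with y hy using hlo y hy
      · refine le_of_tendsto hb ?_
        filter_upwards [Ioo_mem_nhdsLT hab] with y hy using hhi y hy
    · constructor
      · refine ge_of_tendsto (tendsto_prim_right k μ x) ?_
        filter_upwards [Ioo_mem_nhdsGT hxb] with y hy using hlo y ⟨hx.1.trans_lt hy.1, hy.2⟩
      · refine le_of_tendsto (tendsto_prim_right k μ x) ?_
        filter_upwards [Ioo_mem_nhdsGT hxb] with y hy using hhi y ⟨hx.1.trans_lt hy.1, hy.2⟩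
  have hmonoI : MonotoneOn (prim k μ) (Icc a b) := by
    intro x hx y hy hxy
    rcases hxy.eq_or_lt with rfl | hxy
    · exact le_rfl
    obtain ⟨w, hxw, hwy⟩ := exists_between hxy
    have hw : w ∈ Ioo a b := ⟨hx.1.trans_lt hxw, hwy.trans_le hy.2⟩
    have h1 : prim k μ x ≤ prim k μ w := by
      refine le_of_tendsto (tendsto_prim_right k μ x) ?_
      filter_upwards [Ioo_mem_nhdsGT hxw] with z hz
      exact hP ⟨hx.1.trans_lt hz.1, hz.2.trans hw.2⟩ hw hz.2.le
    refine h1.trans ?_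
    rcases hy.2.eq_or_lt with rfl | hyb
    · refine ge_of_tendsto hb ?_
      filter_upwards [Ioo_mem_nhdsLT hwy] with z hz
      exact hP hw ⟨hw.1.trans hz.1, hz.2⟩ hz.1.le
    · exact hP hw ⟨hw.1.trans hwy, hyb⟩ hwy.le
  have hconst : ∀ x y, a < x → x ≤ y → y < b → (∀ z ∈ Icc x y, μ {z} = 0) →
      prim k μ y = prim k μ x := by
    intro x y hax hxy hyb hno
    -- `eq_of_short` makes `P` constant on a right neighbourhood of each point, of length up to `2 *
    -- C / lam`, so the right derivative vanishes.
    refine constant_of_has_deriv_right_zero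
      (fun z hz => (continuousAt_prim (hno z hz)).continuousWithinAt) (fun z hz => ?_) y
      ⟨hxy, le_rfl⟩
    refine (hasDerivWithinAt_const z (Ici z) (prim k μ z)).congr_of_eventuallyEq ?_ rfl
    have hpos : 0 < 2 * C / lam := by positivity
    filter_upwards [Ico_mem_nhdsGE (lt_min hz.2 (lt_add_of_pos_right z hpos))] with w hw
    rcases hw.1.eq_or_lt with rfl | hzw
    · rfl
    have hwy := hw.2.trans_le (min_le_left _ _)
    have hwd := hw.2.trans_le (min_le_right _ _)
    refine (hm.eq_of_short hK hlam hmono hP hKC (hax.trans_le hz.1) hzw (hwy.trans hyb)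
      (hmM _ _ (hax.trans_le hz.1) hzw (hwy.trans hyb)) ?_ fun v hv => hno v
        ⟨hz.1.trans hv.1, hv.2.trans hwy.le⟩).symm
    have h1 : w - z < 2 * C / lam := by linarith
    rw [lt_div_iff₀ hlam] at h1
    linarith
  have hsep := finite_of_separated (a := a) (b := b) (L := 2 * C / lam) (by positivity)
    (J := Ioo a b ∩ {x | μ {x} ≠ 0}) inter_subset_left fun x hx y hy hxy => by
      have := hm.jump_separation hK hlam hmono hP hKC hx.1.1 hxy hy.1.2
        (hmM _ _ hx.1.1 hxy hy.1.2) hx.2 hy.2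
      rw [div_le_iff₀ hlam]
      linarith
  have hL : (b - a) / (2 * C / lam) = (b - a) * lam / (2 * C) := by field_simp
  rw [hL] at hsep
  refine ⟨hmonoI, ⟨hsep.1, inter_subset_left, fun x hx y hy hxy hd => ?_⟩, hbounds, hsep.2⟩
  rcases hxy.eq_or_lt with rfl | hxy
  · rfl
  have hno : ∀ z ∈ Icc x y, z ∈ Ioo a b → μ {z} = 0 := fun z hz hzI => by
    by_contra h
    exact Set.disjoint_left.1 hd hz ⟨hzI, h⟩
  -- Since `x` may be `a` and `y` may be `b`, both values are compared with an interior `c` by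
  -- one-sided limits; the absence of an atom at `b` is used here.
  obtain ⟨c, hxc, hcy⟩ := exists_between hxy
  have hxlim : prim k μ x = prim k μ c := by
    refine tendsto_nhds_unique (tendsto_prim_right k μ x) (tendsto_const_nhds.congr' ?_)
    filter_upwards [Ioo_mem_nhdsGT hxc] with w hw
    exact hconst w c (hx.1.trans_lt hw.1) hw.2.le (hcy.trans_le hy.2) fun z hz =>
      hno z ⟨hw.1.le.trans hz.1, hz.2.trans hcy.le⟩
        ⟨(hx.1.trans_lt hw.1).trans_le hz.1, (hz.2.trans_lt hcy).trans_le hy.2⟩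
  have hyleft : Tendsto (prim k μ) (𝓝[<] y) (𝓝 (prim k μ y)) := by
    have hy0 : μ {y} = 0 := by
      rcases hy.2.eq_or_lt with rfl | hyb
      · exact hμb
      · exact hno y ⟨hxy.le, le_rfl⟩ ⟨hx.1.trans_lt hxy, hyb⟩
    rw [← primLeft_add_singleton, hy0, add_zero]
    exact tendsto_prim_left k μ y
  rw [hxlim]
  refine tendsto_nhds_unique (tendsto_const_nhds.congr' ?_) hyleft
  filter_upwards [Ioo_mem_nhdsLT hcy] with w hw
  exact (hconst c w (hx.1.trans_lt hxc) hw.1.le (hw.2.trans_le hy.2) fun z hz =>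
    hno z ⟨hxc.le.trans hz.1, hz.2.trans hw.2.le⟩
      ⟨(hx.1.trans_lt hxc).trans_le hz.1, (hz.2.trans_lt hw.2).trans_le hy.2⟩).symm

end Structure

end KWC

/-! ### Transfer to the minimizer, for both monotonicity directions -/

theorem mainTheorem3 (K : ℝ≥0 → ℝ≥0) (hK : KWC.Admissible K)
    (a b lam : ℝ) (hab : a < b) (hlam : 0 < lam)
    (g : ℝ → ℝ) (hg : MemLp g ⊤ (volume.restrict (Ioo a b)))
    (M C : ℝ) (hM : 0 < M) (hC : 0 < C) (hKC : KWC.SubaddWith K M C)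
    (hosc : essSup g (volume.restrict (Ioo a b)) - essInf g (volume.restrict (Ioo a b)) ≤ M)
    (U : ℝ → ℝ) (hU : KWC.IsMinimizer K lam a b g U) :
    (KWC.AENondecreasing a b g →
      (∃ V : ℝ → ℝ, U =ᵐ[volume.restrict (Ioo a b)] V ∧ MonotoneOn V (Icc a b) ∧
        KWC.PiecewiseConst a b (KWC.jumpSet a b U) V ∧
        ∀ x ∈ Icc a b, essInf g (volume.restrict (Ioo a b)) ≤ V x ∧
          V x ≤ essSup g (volume.restrict (Ioo a b))) ∧
      (KWC.jumpSet a b U).ncard ≤ ⌊(b - a) * lam / (2 * C)⌋₊ + 1) ∧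
    (KWC.AENonincreasing a b g →
      (∃ V : ℝ → ℝ, U =ᵐ[volume.restrict (Ioo a b)] V ∧ AntitoneOn V (Icc a b) ∧
        KWC.PiecewiseConst a b (KWC.jumpSet a b U) V ∧
        ∀ x ∈ Icc a b, essInf g (volume.restrict (Ioo a b)) ≤ V x ∧
          V x ≤ essSup g (volume.restrict (Ioo a b))) ∧
      (KWC.jumpSet a b U).ncard ≤ ⌊(b - a) * lam / (2 * C)⌋₊ + 1) := by
  obtain ⟨k, μ, hUP, hm, hμb⟩ := hU.exists_isMinPrim hK.map_zero hab hg
  have hgm : AEMeasurable g (volume.restrict (Ioo a b)) := hg.aestronglyMeasurable.aemeasurable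
  -- Real-valued `essSup` and `essInf` bound `g` almost everywhere only once `g` is known to be
  -- essentially bounded.
  have hbd : ∀ᵐ x ∂volume.restrict (Ioo a b), |g x| ≤ (eLpNormEssSup g
      (volume.restrict (Ioo a b))).toReal := by
    have hfin : eLpNormEssSup g (volume.restrict (Ioo a b)) ≠ ⊤ := by
      rw [← eLpNorm_exponent_top]; exact hg.eLpNorm_ne_top
    filter_upwards [ae_le_eLpNormEssSup (f := g) (μ := volume.restrict (Ioo a b))] with x hx
    have := ENNReal.toReal_mono hfin hx
    rwa [toReal_enorm, Real.norm_eq_abs] at this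
  have h₀ : ∀ᵐ x ∂volume.restrict (Ioo a b), essInf g (volume.restrict (Ioo a b)) ≤ g x :=
    ae_essInf_le ⟨_, hbd.mono fun x hx => (abs_le.1 hx).1⟩
  have h₁ : ∀ᵐ x ∂volume.restrict (Ioo a b), g x ≤ essSup g (volume.restrict (Ioo a b)) :=
    ae_le_essSup ⟨_, hbd.mono fun x hx => (abs_le.1 hx).2⟩
  rw [KWC.jumpSet_eq hU.1.1 hUP]
  refine ⟨fun hmono => ?_, fun hanti => ?_⟩
  · obtain ⟨h1, h2, h3, h4⟩ :=
      hm.structure_of_nondecreasing hK hab hlam hgm hμb hC hKC h₀ h₁ hosc hmono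
    exact ⟨⟨KWC.prim k μ, hUP, h1, h2, h3⟩, h4⟩
  -- The reflection `g ↦ -g`, `μ ↦ -μ` preserves minimality and the atoms, and exchanges the two
  -- bounds.
  · have hmono : KWC.AENondecreasing a b fun x => -g x := by
      obtain ⟨h, hh, hgh⟩ := hanti
      refine ⟨fun x => -h x, hh.neg, ?_⟩
      filter_upwards [hgh] with x hx
      rw [hx]
    obtain ⟨h1, h2, h3, h4⟩ :=
      hm.neg.structure_of_nondecreasing hK hab hlam hgm.neg (by simp [hμb]) hC hKC
        (h₁.mono fun x hx => neg_le_neg hx) (h₀.mono fun x hx => neg_le_neg hx)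
        (by linarith) hmono
    have hatoms : {x | (-μ) {x} ≠ 0} = {x | μ {x} ≠ 0} := by ext x; simp
    rw [hatoms] at h2 h4
    refine ⟨⟨KWC.prim k μ, hUP, fun x hx y hy hxy => ?_, ⟨h2.1, h2.2.1, fun x hx y hy hxy hd => ?_⟩,
      fun x hx => ?_⟩, h4⟩
    · have := h1 hx hy hxy
      rw [KWC.prim_neg, KWC.prim_neg] at this
      exact neg_le_neg_iff.1 this
    · have := h2.2.2 x hx y hy hxy hd
      rw [KWC.prim_neg, KWC.prim_neg] at this
      exact neg_inj.1 this
    · have := h3 x hx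
      rw [KWC.prim_neg] at this
      exact ⟨neg_le_neg_iff.1 this.2, neg_le_neg_iff.1 this.1⟩
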